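/- Write $s_1(M)\ge s_2(M)\ge\dots\ge s_n(M)$ for the singular values of a complex $n\times n$ matrix $M$, counted with multiplicity. For $n\ge 1$ and $p_n\in(0,1]$ let $A_n$ be the $n\times n$ matrix with entries $\xi_{i,j}\delta_{i,j}$, where $\{\xi_{i,j}\}_{i,j=1}^n$ are i.i.d. real-valued random variables with zero mean and unit variance, $\{\delta_{i,j}\}_{i,j=1}^n$ are i.i.d. Bernoulli random variables with $\mathbb P(\delta_{i,j}=1)=p_n$, and the two families are independent of each other. There exist constants $c>0$ and $C>0$, depending only on the tail $t\mapsto\mathbb P(|\xi_{1,1}|>t)$, $t\ge 0$, of the distribution of the $\xi_{i,j}$, such that the following holds. Let $\psi:\mathbb N\to\mathbb N$ and let $n\ge1$ be such that $\psi(n)<n$ and $$\min\left\{p_n\psi(n),\ \frac{\psi(n)^2}{n}\right\}\ \ge\ C\log n .$$ Then for every $w\in\mathbb C$ with $|w|<1$, $$\mathbb P\left(\bigcup_{i=3\psi(n)}^{n-1}\left\{s_{n-i}\left(\frac{A_n}{\sqrt{np_n}}-wI_n\right)\le c\,\frac in\right\}\right)\ \le\ \frac{2}{n^2}.$$ -/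

import Mathlib

open MeasureTheory ProbabilityTheory

/-- `IsSparseArray P ξ δ p`: on the probability space `(Ω, P)`, the entries `ξ i j` are i.i.d. real
random variables with mean zero and unit variance, the `δ i j` are i.i.d. Bernoulli random
variables with parameter `p`, and the two families are independent of each other. -/
structure IsSparseArray {Ω : Type*} [MeasurableSpace Ω] (P : Measure Ω) {n : ℕ}
    (ξ δ : Fin n → Fin n → Ω → ℝ) (p : ℝ) : Prop where
  measurable_xi : ∀ i j, Measurable (ξ i j)
  measurable_delta : ∀ i j, Measurable (δ i j)
  /-- all `2 n ^ 2` random variables are jointly independent -/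
  indep : iIndepFun (Sum.elim (fun e : Fin n × Fin n => ξ e.1 e.2)
    (fun e : Fin n × Fin n => δ e.1 e.2)) P
  identDistrib_xi : ∀ i j k l, IdentDistrib (ξ i j) (ξ k l) P P
  memLp_xi : ∀ i j, MemLp (ξ i j) 2 P
  mean_xi : ∀ i j, ∫ ω, ξ i j ω ∂P = 0
  variance_xi : ∀ i j, variance (ξ i j) P = 1
  delta_one : ∀ i j, P.real {ω | δ i j ω = 1} = p
  delta_zero : ∀ i j, P.real {ω | δ i j ω = 0} = 1 - p

/-- The matrix `A_n / √(n p) - w I_n`, where `A_n` has entries `ξ i j * δ i j`, at the sample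
point `ω`. -/
noncomputable def shiftedMatrix {Ω : Type*} {n : ℕ} (ξ δ : Fin n → Fin n → Ω → ℝ) (p : ℝ) (w : ℂ)
    (ω : Ω) : Matrix (Fin n) (Fin n) ℂ :=
  (Matrix.of fun i j => ((ξ i j ω * δ i j ω / √(n * p) : ℝ) : ℂ)) -
    w • (1 : Matrix (Fin n) (Fin n) ℂ)

/-- The `k`-th largest singular value `s_k(M)`, counted with multiplicity, for `1 ≤ k ≤ n`
(Mathlib's `LinearMap.singularValues` is the decreasing sequence indexed from zero). -/
noncomputable def singularValue {n : ℕ} (M : Matrix (Fin n) (Fin n) ℂ) (k : ℕ) : ℝ :=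
  (Matrix.toEuclideanLin M).singularValues (k - 1)

/-!
The proof follows the negative second moment method. Fix `i`, put `k = ⌊i / 2⌋`, and keep only the
first `n - k` rows of `A - w √(n p)`, where `A` is the unnormalized sparse matrix. If
`s_{n - i}` is at most `c i / n`, the matrix is small on a subspace of dimension `i + 1`
(`exists_submodule_norm_le_of_singularValues_le`), and if every kept row had distance at least `d`
from the span of the other kept rows, the dual basis of these rows would have vectors of norm at most
`1 / d`, which makes such a subspace impossible for small `c` and `d ^ 2` of order `p k`
(`finrank_mul_sq_le_of_dist_span`). So some kept row is at distance less than `d` from the span of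
the others (`exists_row_near_span_of_singularValue_le`). A union bound over at most `n ^ 2` pairs
`(i, j)` reduces the theorem to showing that this has probability at most `n ^ (-4)` for each row.

The row `X - w √(n p) e_j` is independent of the other rows. Enlarging their span by `e_j` absorbs
the shift, and the enlarged subspace `H` still has codimension at least `k`. Conditionally on `H` one
has to bound the lower tail of the squared norm of the projection `Q X` of `X` to the orthogonal
complement of `H`, a positive quadratic form in independent variables that may be unbounded. Each
coordinate is exchanged, with probability one half, with an independent copy, but only if both are at
most `K` in absolute value; this does not change the law of `X`. Given the pairs, `Q X` becomes
`s + ∑ ± g_a` with a fixed shift `s` and vectors `g_a` that form a bounded operator. The signs are then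
averaged one at a time. By `cosh (2 x) ≤ exp (2 x ^ 2)`, averaging `exp (-B (s ± g, s ± g))` over one
sign gives at most `exp (-B (g, g)) exp (-B' (s, s))`, where `B'` is the quadratic form
`B (s, s) - κ B (g, s) ^ 2` with a suitable `κ ≥ 2`. This form is an infimal convolution of `B`, and
Legendre duality shows that it never falls below half of the original form
(`sum_exp_neg_norm_sq_signs_le`). Averaging over the pairs then yields
`E exp (-‖Q X‖ ^ 2 / (4 K ^ 2)) ≤ exp (-p k / (64 K ^ 2))`
(`integral_exp_neg_norm_sq_starProjection_le`), where `K` depends only on the tail and is such that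
the second moment of the entries beyond `K` is at most `1 / 4` (`exists_truncation_level`,
`IsSparseArray.le_integral_halfDiff_sq`). The hypothesis `p ψ ≥ C log n` makes the resulting
probability at most `n ^ (-4)`.
-/

/-! ### Singular values and distances between rows -/

section Singular
open Module
variable {E F : Type*} [NormedAddCommGroup E] [InnerProductSpace ℂ E] [FiniteDimensional ℂ E]
  [NormedAddCommGroup F] [InnerProductSpace ℂ F] [FiniteDimensional ℂ F]

/-- The easy half of the min-max principle: `V` is spanned by the eigenvectors of `T* T` with index at
least `k`. -/
theorem exists_submodule_norm_le_of_singularValues_le (T : E →ₗ[ℂ] F) {n k : ℕ}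
    (hn : finrank ℂ E = n) (hk : k < n) {τ : ℝ} (hτ : T.singularValues k ≤ τ) :
    ∃ V : Submodule ℂ E, finrank ℂ V = n - k ∧ ∀ x ∈ V, ‖T x‖ ≤ τ * ‖x‖ := by
  have hτ0 : 0 ≤ τ := (T.singularValues_nonneg k).trans hτ
  have hsym := T.isSymmetric_adjoint_comp_self
  set b := hsym.eigenvectorBasis hn with hb
  refine ⟨Submodule.span ℂ (Set.range fun l : {l : Fin n // k ≤ l} => b l), ?_, ?_⟩
  · rw [finrank_span_eq_card]
    · rw [Fintype.card_subtype]
      have h1 := Finset.card_filter_add_card_filter_not (s := (Finset.univ : Finset (Fin n)))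
        (p := fun l => (l : ℕ) < k)
      rw [Fin.card_filter_val_lt] at h1
      simp only [not_lt, Finset.card_univ, Fintype.card_fin] at h1
      omega
    · exact b.orthonormal.linearIndependent.comp _ Subtype.val_injective
  · intro x hx
    have hzero : ∀ l : Fin n, (l : ℕ) < k → b.repr x l = 0 := by
      intro l hl
      rw [b.repr_apply_apply]
      refine Submodule.span_induction (p := fun x _ => inner ℂ (b l) x = 0) ?_ ?_ ?_ ?_ hx
      · rintro _ ⟨m, rfl⟩
        apply b.orthonormal.2
        rintro rfl
        exact absurd m.2 (by omega)
      · simp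
      · intro x y _ _ hx hy
        rw [inner_add_right, hx, hy, add_zero]
      · intro c x _ hx
        rw [inner_smul_right, hx, mul_zero]
    have h1 : ‖T x‖ ^ 2 = ∑ l, hsym.eigenvalues hn l * ‖b.repr x l‖ ^ 2 := by
      have h2 : inner ℂ (T x) (T x) = inner ℂ x ((LinearMap.adjoint T ∘ₗ T) x) := by
        rw [LinearMap.comp_apply, LinearMap.adjoint_inner_right]
      rw [inner_self_eq_norm_sq_to_K, ← b.repr.inner_map_map, PiLp.inner_apply] at h2
      have h3 : ((‖T x‖ ^ 2 : ℝ) : ℂ) =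
          ((∑ l, hsym.eigenvalues hn l * ‖b.repr x l‖ ^ 2 : ℝ) : ℂ) := by
        push_cast
        refine h2.trans (Finset.sum_congr rfl fun l _ => ?_)
        rw [hsym.eigenvectorBasis_apply_self_apply hn x l, ← hb]
        simp only [RCLike.inner_apply, mul_assoc, RCLike.mul_conj]
        rfl
      exact_mod_cast h3
    have h4 : ‖T x‖ ^ 2 ≤ (τ * ‖x‖) ^ 2 := by
      rw [h1, mul_pow, ← b.repr.norm_map x, EuclideanSpace.norm_sq_eq, Finset.mul_sum]
      refine Finset.sum_le_sum fun l _ => ?_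
      by_cases hl : (l : ℕ) < k
      · simp [hzero l hl]
      · gcongr
        rw [← T.sq_singularValues_fin hn l]
        have := T.singularValues_antitone (not_lt.1 hl)
        have := T.singularValues_nonneg l
        gcongr
        linarith
    exact le_of_sq_le_sq h4 (by positivity)

/-- If each `r j` has distance at least `d` from the span of the others, then the basis of the span of
the `r j` dual to them has vectors of norm at most `d⁻¹`. The vector `u j` is the component of `r j`
orthogonal to the others, divided by its squared norm. -/
theorem exists_dual_vectors {ι : Type*} (r : ι → E) {d : ℝ} (hd : 0 < d)
    (hr : ∀ j, ∀ z ∈ Submodule.span ℂ (r '' {j}ᶜ), d ≤ ‖r j - z‖) :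
    ∃ u : ι → E, (∀ j, inner ℂ (r j) (u j) = 1) ∧ (∀ l j, l ≠ j → inner ℂ (r l) (u j) = 0) ∧
      (∀ j, u j ∈ Submodule.span ℂ (Set.range r)) ∧ ∀ j, ‖u j‖ ≤ d⁻¹ := by
  let H : ι → Submodule ℂ E := fun j => Submodule.span ℂ (r '' {j}ᶜ)
  let v : ι → E := fun j => r j - (H j).starProjection (r j)
  have hv : ∀ j, d ≤ ‖v j‖ := fun j => hr j _ (Submodule.starProjection_apply_mem _ _)
  have hv0 : ∀ j, 0 < ‖v j‖ := fun j => hd.trans_le (hv j)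
  have hvH : ∀ j, ∀ z ∈ H j, inner ℂ z (v j) = 0 := fun j z hz =>
    (Submodule.mem_orthogonal _ _).1 (Submodule.sub_starProjection_mem_orthogonal (r j)) z hz
  refine ⟨fun j => ((‖v j‖ : ℂ) ^ 2)⁻¹ • v j, fun j => ?_, fun l j hlj => ?_, fun j => ?_,
    fun j => ?_⟩
  · have h1 : inner ℂ (r j) (v j) = (‖v j‖ : ℂ) ^ 2 := by
      have h2 : r j = v j + (H j).starProjection (r j) := by simp [v]
      conv_lhs => rw [h2]
      rw [inner_add_left, hvH j _ (Submodule.starProjection_apply_mem _ _), add_zero,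
        inner_self_eq_norm_sq_to_K]
      rfl
    rw [inner_smul_right, h1, inv_mul_cancel₀]
    exact pow_ne_zero _ (by exact_mod_cast (hv0 j).ne')
  · rw [inner_smul_right, hvH j _ (Submodule.subset_span ⟨l, hlj, rfl⟩), mul_zero]
  · refine Submodule.smul_mem _ _ (Submodule.sub_mem _ (Submodule.subset_span ⟨j, rfl⟩) ?_)
    exact Submodule.span_mono (Set.image_subset_range _ _) (Submodule.starProjection_apply_mem _ _)
  · rw [norm_smul, norm_inv, norm_pow, Complex.norm_real, norm_norm, pow_two, mul_inv, mul_assoc,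
      inv_mul_cancel₀ (hv0 j).ne', mul_one]
    exact inv_anti₀ hd (hv j)

/-- A form of the negative second moment identity. If each `r j` has distance at least `d` from the
span of the others, then the map `x ↦ (⟪r j, x⟫)_j` can be smaller than `τ` only on a subspace `V`
of small dimension. With `u j` the dual vectors and `U` the intersection of `V` with the span of the
`r j`, the trace of the identity of `U` is `∑ a j, ⟪r j, b a⟫ ⟪b a, u j⟫` for an orthonormal basis
`b` of `U`; the Cauchy-Schwarz inequality bounds its square by
`(dim U * τ ^ 2) * (∑ j, ‖u j‖ ^ 2)`. -/
theorem finrank_mul_sq_le_of_dist_span {ι : Type*} [Fintype ι] (r : ι → E) {d τ : ℝ} (hd : 0 < d)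
    (hr : ∀ j, ∀ z ∈ Submodule.span ℂ (r '' {j}ᶜ), d ≤ ‖r j - z‖)
    (V : Submodule ℂ E) (hV : ∀ x ∈ V, ∑ j, ‖inner ℂ (r j) x‖ ^ 2 ≤ τ ^ 2 * ‖x‖ ^ 2) :
    ((finrank ℂ V : ℝ) + Fintype.card ι - finrank ℂ E) * d ^ 2 ≤ Fintype.card ι * τ ^ 2 := by
  classical
  obtain ⟨u, hu1, hu0, huW, hud⟩ := exists_dual_vectors r hd hr
  set W := Submodule.span ℂ (Set.range r) with hW
  have hli : LinearIndependent ℂ r := by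
    rw [linearIndependent_iff_notMem_span]
    intro j hj
    have := hr j (r j) (by rwa [Set.compl_eq_univ_sdiff])
    rw [sub_self, norm_zero] at this
    linarith
  have hWr : finrank ℂ W = Fintype.card ι := finrank_span_eq_card hli
  have hdim : finrank ℂ V + Fintype.card ι ≤ finrank ℂ (V ⊓ W : Submodule ℂ E) + finrank ℂ E := by
    have h1 := Submodule.finrank_sup_add_finrank_inf_eq V W
    have h2 := Submodule.finrank_le (V ⊔ W)
    omega
  set U : Submodule ℂ E := V ⊓ W with hU
  let b := stdOrthonormalBasis ℂ U
  have hbo : Orthonormal ℂ (fun a => (b a : E)) :=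
    b.orthonormal.comp_linearIsometry U.subtypeₗᵢ
  -- The vectors `u j` are dual to the `r j` inside the span of the `r j`.
  have hrec : ∀ x ∈ W, x = ∑ j, inner ℂ (r j) x • u j := by
    intro x hx
    have h1 : x - ∑ j, inner ℂ (r j) x • u j ∈ W :=
      Submodule.sub_mem _ hx (Submodule.sum_mem _ fun j _ => Submodule.smul_mem _ _ (huW j))
    have h2 : ∀ y ∈ W, inner ℂ y (x - ∑ j, inner ℂ (r j) x • u j) = 0 := by
      intro y hy
      refine Submodule.span_induction
        (p := fun y _ => inner ℂ y (x - ∑ j, inner ℂ (r j) x • u j) = 0) ?_ ?_ ?_ ?_ hy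
      · rintro _ ⟨l, rfl⟩
        rw [inner_sub_right, inner_sum, Finset.sum_eq_single l]
        · rw [inner_smul_right, hu1, mul_one, sub_self]
        · intro j _ hj
          rw [inner_smul_right, hu0 l j hj.symm, mul_zero]
        · simp
      · simp
      · intro y z _ _ hy hz
        rw [inner_add_left, hy, hz, add_zero]
      · intro c y _ hy
        rw [inner_smul_left, hy, mul_zero]
    exact sub_eq_zero.1 (inner_self_eq_zero.1 (h2 _ h1))
  set ρ : ℝ := (finrank ℂ U : ℝ) with hρ
  have hA : ∑ q : Fin (finrank ℂ U) × ι, ‖inner ℂ (r q.2) (b q.1 : E)‖ ^ 2 ≤ ρ * τ ^ 2 := by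
    rw [Fintype.sum_prod_type]
    calc _ ≤ ∑ a : Fin (finrank ℂ U), τ ^ 2 * ‖(b a : E)‖ ^ 2 :=
          Finset.sum_le_sum fun a _ => hV _ (b a).2.1
      _ = ρ * τ ^ 2 := by simp [hbo.1, hρ]
  have hB : ∑ q : Fin (finrank ℂ U) × ι, ‖inner ℂ (b q.1 : E) (u q.2)‖ ^ 2
      ≤ Fintype.card ι * (d⁻¹) ^ 2 := by
    rw [Fintype.sum_prod_type_right]
    calc _ ≤ ∑ j : ι, (d⁻¹) ^ 2 := by
          refine Finset.sum_le_sum fun j _ => ?_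
          refine (hbo.sum_inner_products_le (u j) (s := Finset.univ)).trans ?_
          have := hud j
          gcongr
      _ = _ := by simp
  have htr : ρ ≤ ∑ q : Fin (finrank ℂ U) × ι,
      ‖inner ℂ (r q.2) (b q.1 : E)‖ * ‖inner ℂ (b q.1 : E) (u q.2)‖ := by
    rw [Fintype.sum_prod_type]
    calc ρ = ∑ a : Fin (finrank ℂ U), (1 : ℝ) := by simp [hρ]
      _ ≤ _ := by
          refine Finset.sum_le_sum fun a _ => ?_
          have h1 : (1 : ℝ) = ‖inner ℂ (b a : E) (b a : E)‖ := by
            rw [inner_self_eq_norm_sq_to_K, hbo.1]; simp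
          have h2 : inner ℂ (b a : E) (b a : E)
              = ∑ j, inner ℂ (r j) (b a : E) * inner ℂ (b a : E) (u j) := by
            refine (congrArg (inner ℂ (b a : E)) (hrec (b a) (b a).2.2)).trans ?_
            rw [inner_sum]
            exact Finset.sum_congr rfl fun j _ => inner_smul_right _ _ _
          rw [h1, h2]
          refine (norm_sum_le _ _).trans_eq ?_
          simp only [norm_mul]
  have hCS := Finset.sum_mul_sq_le_sq_mul_sq Finset.univ
    (fun q : Fin (finrank ℂ U) × ι => ‖inner ℂ (r q.2) (b q.1 : E)‖)
    (fun q => ‖inner ℂ (b q.1 : E) (u q.2)‖)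
  have hρ0 : 0 ≤ ρ := by positivity
  have h3 : ρ ^ 2 ≤ (ρ * τ ^ 2) * (Fintype.card ι * (d⁻¹) ^ 2) :=
    (pow_le_pow_left₀ hρ0 htr 2).trans (hCS.trans (mul_le_mul hA hB (by positivity) (by positivity)))
  have h4 : ρ * d ^ 2 ≤ Fintype.card ι * τ ^ 2 := by
    rcases hρ0.eq_or_lt with h | h
    · rw [← h, zero_mul]; positivity
    · have h5 : ρ * (ρ * d ^ 2) ≤ ρ * (Fintype.card ι * τ ^ 2) := by
        have := mul_le_mul_of_nonneg_right h3 (sq_nonneg d)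
        have hdd : (d⁻¹) ^ 2 * d ^ 2 = 1 := by rw [← mul_pow, inv_mul_cancel₀ hd.ne', one_pow]
        calc ρ * (ρ * d ^ 2) = ρ ^ 2 * d ^ 2 := by ring
          _ ≤ _ := this
          _ = ρ * (Fintype.card ι * τ ^ 2) * ((d⁻¹) ^ 2 * d ^ 2) := by ring
          _ = _ := by rw [hdd, mul_one]
      exact le_of_mul_le_mul_left h5 h
  refine le_trans ?_ h4
  gcongr
  have : (finrank ℂ V : ℝ) + Fintype.card ι ≤ ρ + finrank ℂ E := by
    rw [hρ]; exact_mod_cast hdim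
  linarith

end Singular

/-! ### Laplace transform of a random signed sum -/

section Signs
variable {E : Type*} [NormedAddCommGroup E] [InnerProductSpace ℝ E]

theorem exp_neg_add_exp_neg_le (q x b : ℝ) :
    Real.exp (-(q - 2 * x + b)) + Real.exp (-(q + 2 * x + b)) ≤
      2 * (Real.exp (-b) * Real.exp (-(q - 2 * x ^ 2))) := by
  have h := Real.cosh_le_exp_half_sq (2 * x)
  rw [Real.cosh_eq] at h
  have h1 : Real.exp (-(q - 2 * x + b)) = Real.exp (-b) * Real.exp (-q) * Real.exp (2 * x) := by
    rw [← Real.exp_add, ← Real.exp_add]; ring_nf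
  have h2 : Real.exp (-(q + 2 * x + b)) = Real.exp (-b) * Real.exp (-q) * Real.exp (-(2 * x)) := by
    rw [← Real.exp_add, ← Real.exp_add]; ring_nf
  have h3 : Real.exp (-(q - 2 * x ^ 2)) = Real.exp (-q) * Real.exp ((2 * x) ^ 2 / 2) := by
    rw [← Real.exp_add]; ring_nf
  rw [h1, h2, h3]
  have := mul_le_mul_of_nonneg_left h (by positivity : 0 ≤ 2 * (Real.exp (-b) * Real.exp (-q)))
  nlinarith

/-- The induction behind `sum_exp_neg_norm_sq_signs_le`: the signs in `J` are averaged out one after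
the other, and the quadratic form `z ↦ B z z` records the effect of the signs outside `J` that have
been averaged out before. The last hypothesis on `B` says that `B z z` is at least the Legendre dual
of `w ↦ ‖w‖ ^ 2 + 4 * ∑ a ∉ J, ⟪g a, w⟫ ^ 2`; by the assumption on `g` the latter is at most
`2 * ‖w‖ ^ 2`, so that `B z z` never drops below `‖z‖ ^ 2 / 2`. -/
theorem sum_powerset_exp_neg_bilin_le {ι : Type*} [Fintype ι] [DecidableEq ι] (g : ι → E)
    (hg : ∀ w, ∑ a, inner ℝ (g a) w ^ 2 ≤ ‖w‖ ^ 2 / 4) (J : Finset ι) :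
    ∀ B : LinearMap.BilinForm ℝ E, (∀ x y, B x y = B y x) → (∀ x, 0 ≤ B x x) →
      (∀ x, B x x ≤ ‖x‖ ^ 2) →
      (∀ z w, 2 * inner ℝ z w - ‖w‖ ^ 2 - 4 * ∑ a ∈ Jᶜ, inner ℝ (g a) w ^ 2 ≤ B z z) →
      ∀ s : E, ∑ ε ∈ J.powerset,
          Real.exp (-B (s + ∑ a ∈ J, (if a ∈ ε then (1 : ℝ) else -1) • g a)
            (s + ∑ a ∈ J, (if a ∈ ε then (1 : ℝ) else -1) • g a))
        ≤ 2 ^ J.card * Real.exp (-∑ a ∈ J, ‖g a‖ ^ 2 / 2) := by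
  induction J using Finset.induction_on with
  | empty =>
    intro B _ h0 _ _ s
    simp [h0]
  | insert i J hi ih =>
    intro B hsym h0 hle hR s
    set b := B (g i) (g i) with hb
    have hgi : ‖g i‖ ^ 2 ≤ 1 / 4 := by
      have h1 := (Finset.single_le_sum (fun a _ => sq_nonneg (inner ℝ (g a) (g i)))
        (Finset.mem_univ i)).trans (hg (g i))
      simp only [real_inner_self_eq_norm_sq] at h1
      by_contra! h
      nlinarith
    have hb4 : b ≤ 1 / 4 := (hle _).trans hgi
    have hb0 : 0 ≤ b := h0 _
    -- At `w = g i / 2` the duality hypothesis gives `B (g i) (g i) ≥ ‖g i‖ ^ 2 / 2`.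
    have hbg : ‖g i‖ ^ 2 / 2 ≤ b := by
      have h1 := hR (g i) ((1 / 2 : ℝ) • g i)
      have h2 : ∑ a ∈ (insert i J)ᶜ, inner ℝ (g a) ((1 / 2 : ℝ) • g i) ^ 2
          ≤ ‖(1 / 2 : ℝ) • g i‖ ^ 2 / 4 :=
        (Finset.sum_le_sum_of_subset_of_nonneg (Finset.subset_univ _)
          fun a _ _ => sq_nonneg _).trans (hg _)
      rw [inner_smul_right, real_inner_self_eq_norm_sq] at h1
      rw [norm_smul, mul_pow] at h1 h2
      norm_num at h1 h2
      linarith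
    -- Averaging over the sign of `g i` replaces `B` by the infimal convolution
    -- `z ↦ min_y B (z - y g) (z - y g) + y ^ 2 / 4`, which is `B' z z` below.
    set κ : ℝ := 1 / (1 / 4 + b) with hκ
    have hκ2 : 2 ≤ κ := by rw [hκ, le_div_iff₀ (by linarith)]; linarith
    let B' : LinearMap.BilinForm ℝ E := B - κ • LinearMap.BilinForm.linMulLin (B (g i)) (B (g i))
    have hB' : ∀ x y, B' x y = B x y - κ * (B (g i) x * B (g i) y) := fun x y => rfl
    have hconv : ∀ z, B' z z = B (z - (κ * B (g i) z) • g i) (z - (κ * B (g i) z) • g i)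
        + (κ * B (g i) z) ^ 2 / 4 := by
      intro z
      rw [hB']
      simp only [map_sub, map_smul, LinearMap.sub_apply, LinearMap.smul_apply, smul_eq_mul,
        hsym z (g i), ← hb]
      have : κ * (1 / 4 + b) = 1 := by rw [hκ]; field_simp
      linear_combination (- κ * (B (g i) z) ^ 2) * this
    have hkey : ∀ s : E, Real.exp (-B (s - g i) (s - g i)) + Real.exp (-B (s + g i) (s + g i))
        ≤ 2 * (Real.exp (-(‖g i‖ ^ 2 / 2)) * Real.exp (-B' s s)) := by
      intro s
      have e1 : B (s - g i) (s - g i) = B s s - 2 * B (g i) s + b := by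
        simp only [map_sub, LinearMap.sub_apply, hsym s (g i), ← hb]; ring
      have e2 : B (s + g i) (s + g i) = B s s + 2 * B (g i) s + b := by
        simp only [map_add, LinearMap.add_apply, hsym s (g i), ← hb]; ring
      rw [e1, e2]
      refine (exp_neg_add_exp_neg_le _ _ _).trans ?_
      have : B' s s ≤ B s s - 2 * B (g i) s ^ 2 := by
        rw [hB']; nlinarith [sq_nonneg (B (g i) s)]
      gcongr
    have hIH := ih B' (fun x y => by rw [hB', hB', hsym x y, mul_comm (B (g i) x)])
      (fun x => by rw [hconv]; have := h0 (x - (κ * B (g i) x) • g i); positivity)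
      (fun x => by rw [hB']; nlinarith [hle x, mul_self_nonneg (B (g i) x)])
      (fun z w => by
        rw [hconv]
        set y := κ * B (g i) z
        have h1 := hR (z - y • g i) w
        rw [inner_sub_left, inner_smul_left] at h1
        have h2 : ∑ a ∈ Jᶜ, inner ℝ (g a) w ^ 2
            = inner ℝ (g i) w ^ 2 + ∑ a ∈ (insert i J)ᶜ, inner ℝ (g a) w ^ 2 := by
          rw [Finset.compl_insert]
          exact (Finset.add_sum_erase Jᶜ (fun a => inner ℝ (g a) w ^ 2) (by simpa using hi)).symm
        rw [h2]
        simp only [conj_trivial] at h1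
        nlinarith [sq_nonneg (y / 2 - 2 * inner ℝ (g i) w)]) s
    rw [Finset.sum_powerset_insert hi, ← Finset.sum_add_distrib]
    have hterm : ∀ ε ∈ J.powerset,
        Real.exp (-B (s + ∑ a ∈ insert i J, (if a ∈ ε then (1 : ℝ) else -1) • g a)
            (s + ∑ a ∈ insert i J, (if a ∈ ε then (1 : ℝ) else -1) • g a)) +
        Real.exp (-B (s + ∑ a ∈ insert i J, (if a ∈ insert i ε then (1 : ℝ) else -1) • g a)
            (s + ∑ a ∈ insert i J, (if a ∈ insert i ε then (1 : ℝ) else -1) • g a))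
        ≤ 2 * (Real.exp (-(‖g i‖ ^ 2 / 2)) *
          Real.exp (-B' (s + ∑ a ∈ J, (if a ∈ ε then (1 : ℝ) else -1) • g a)
            (s + ∑ a ∈ J, (if a ∈ ε then (1 : ℝ) else -1) • g a))) := by
      intro ε hε
      have hiε : i ∉ ε := fun h => hi (Finset.mem_powerset.1 hε h)
      have e1 : s + ∑ a ∈ insert i J, (if a ∈ ε then (1 : ℝ) else -1) • g a
          = (s + ∑ a ∈ J, (if a ∈ ε then (1 : ℝ) else -1) • g a) - g i := by
        rw [Finset.sum_insert hi, if_neg hiε, neg_one_smul]; abel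
      have e2 : s + ∑ a ∈ insert i J, (if a ∈ insert i ε then (1 : ℝ) else -1) • g a
          = (s + ∑ a ∈ J, (if a ∈ ε then (1 : ℝ) else -1) • g a) + g i := by
        rw [Finset.sum_insert hi, if_pos (Finset.mem_insert_self _ _), one_smul]
        have : ∀ a ∈ J, (if a ∈ insert i ε then (1 : ℝ) else -1) • g a
            = (if a ∈ ε then (1 : ℝ) else -1) • g a := by
          intro a ha
          have : a ≠ i := fun h => hi (h ▸ ha)
          simp [Finset.mem_insert, this]
        rw [Finset.sum_congr rfl this]; abel
      rw [e1, e2]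
      exact hkey _
    refine (Finset.sum_le_sum hterm).trans ?_
    rw [← Finset.mul_sum, ← Finset.mul_sum, Finset.card_insert_of_notMem hi, Finset.sum_insert hi,
      neg_add, Real.exp_add]
    calc _ ≤ 2 * (Real.exp (-(‖g i‖ ^ 2 / 2)) *
          (2 ^ J.card * Real.exp (-∑ a ∈ J, ‖g a‖ ^ 2 / 2))) := by gcongr
      _ = _ := by ring

/-- The average of `exp (-‖s + ∑ a, ± g a‖ ^ 2)` over all choices of signs is at most
`exp (-∑ a, ‖g a‖ ^ 2 / 2)`, whatever the shift `s`, provided the operator with columns `2 • g a` is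
a contraction. -/
theorem sum_exp_neg_norm_sq_signs_le {ι : Type*} [Fintype ι] [DecidableEq ι] (g : ι → E)
    (hg : ∀ w, ∑ a, inner ℝ (g a) w ^ 2 ≤ ‖w‖ ^ 2 / 4) (s : E) :
    ∑ ε : Finset ι, Real.exp (-‖s + ∑ a, (if a ∈ ε then (1 : ℝ) else -1) • g a‖ ^ 2)
      ≤ 2 ^ Fintype.card ι * Real.exp (-∑ a, ‖g a‖ ^ 2 / 2) := by
  have h := sum_powerset_exp_neg_bilin_le g hg Finset.univ (innerₗ E)
    (fun x y => real_inner_comm y x) (fun x => real_inner_self_nonneg)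
    (fun x => (real_inner_self_eq_norm_sq x).le)
    (fun z w => by
      have := real_inner_self_nonneg (x := z - w)
      rw [real_inner_sub_sub_self] at this
      simp only [Finset.compl_univ, Finset.sum_empty, innerₗ_apply_apply]
      rw [← real_inner_self_eq_norm_sq w]
      linarith) s
  simpa only [Finset.powerset_univ, innerₗ_apply_apply, real_inner_self_eq_norm_sq,
    Finset.card_univ] using h

end Signs

/-! ### Exchanging an entry with an independent copy -/

section Swap

/-- Half the difference of the two coordinates if both are bounded by `K`, and zero otherwise. Adding
`± halfDiff K z` to `z.1 - halfDiff K z` gives `z.1` for the sign `+`, while for the sign `-` it gives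
`z.2` if both coordinates are bounded by `K`, and `z.1` otherwise. -/
noncomputable def halfDiff (K : ℝ) (z : ℝ × ℝ) : ℝ :=
  if |z.1| ≤ K ∧ |z.2| ≤ K then (z.1 - z.2) / 2 else 0

theorem measurableSet_both_abs_le (K : ℝ) : MeasurableSet {z : ℝ × ℝ | |z.1| ≤ K ∧ |z.2| ≤ K} :=
  MeasurableSet.inter
    (measurableSet_le (f := fun z : ℝ × ℝ => |z.1|) (g := fun _ => K) (by fun_prop) (by fun_prop))
    (measurableSet_le (f := fun z : ℝ × ℝ => |z.2|) (g := fun _ => K) (by fun_prop) (by fun_prop))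

theorem measurable_halfDiff (K : ℝ) : Measurable (halfDiff K) :=
  Measurable.ite (measurableSet_both_abs_le K) (by fun_prop) (by fun_prop)

theorem abs_halfDiff_le {K : ℝ} (hK : 0 ≤ K) (z : ℝ × ℝ) : |halfDiff K z| ≤ K := by
  unfold halfDiff
  split_ifs with h
  · have h1 := abs_le.1 h.1
    have h2 := abs_le.1 h.2
    rw [abs_le]
    constructor <;> linarith
  · simpa using hK

/-- Swapping the coordinates of `z` on the symmetric set where both are bounded by `K` preserves
`μ.prod μ`, so the first coordinate still has law `μ` after the swap. -/
theorem measurePreserving_swap_bounded (μ : Measure ℝ) [IsProbabilityMeasure μ] (K : ℝ) :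
    MeasurePreserving (fun z : ℝ × ℝ => z.1 - halfDiff K z - halfDiff K z) (μ.prod μ) μ := by
  have hm : Measurable (fun z : ℝ × ℝ => z.1 - halfDiff K z - halfDiff K z) :=
    (measurable_fst.sub (measurable_halfDiff K)).sub (measurable_halfDiff K)
  refine ⟨hm, ?_⟩
  ext A hA
  rw [Measure.map_apply hm hA]
  set S := {z : ℝ × ℝ | |z.1| ≤ K ∧ |z.2| ≤ K} with hS
  have hSm : MeasurableSet S := measurableSet_both_abs_le K
  rw [← measure_inter_add_sdiff _ hSm]
  have h1 : (fun z : ℝ × ℝ => z.1 - halfDiff K z - halfDiff K z) ⁻¹' A ∩ S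
      = Prod.swap ⁻¹' (Prod.fst ⁻¹' A ∩ S) := by
    ext z
    simp only [Set.mem_inter_iff, Set.mem_preimage, hS, Set.mem_ofPred_eq, Prod.fst_swap,
      Prod.snd_swap]
    constructor
    · rintro ⟨h, hz⟩
      rw [halfDiff, if_pos hz] at h
      exact ⟨by convert h using 1; ring, hz.2, hz.1⟩
    · rintro ⟨h, hz⟩
      refine ⟨?_, hz.2, hz.1⟩
      rw [halfDiff, if_pos ⟨hz.2, hz.1⟩]
      convert h using 1; ring
  have h2 : (fun z : ℝ × ℝ => z.1 - halfDiff K z - halfDiff K z) ⁻¹' A \ S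
      = Prod.fst ⁻¹' A \ S := by
    ext z
    simp only [Set.mem_sdiff, Set.mem_preimage]
    refine and_congr_left fun hz => ?_
    rw [halfDiff, if_neg (show ¬(|z.1| ≤ K ∧ |z.2| ≤ K) from hz), sub_zero, sub_zero]
  have hfst : MeasurableSet ((Prod.fst : ℝ × ℝ → ℝ) ⁻¹' A) := measurable_fst hA
  rw [h1, h2, Measure.measurePreserving_swap.measure_preimage (hfst.inter hSm).nullMeasurableSet,
    measure_inter_add_sdiff _ hSm, measurePreserving_fst.measure_preimage hA.nullMeasurableSet]

theorem measurePreserving_add_sign_halfDiff (μ : Measure ℝ) [IsProbabilityMeasure μ] (K : ℝ)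
    (P : Prop) [Decidable P] :
    MeasurePreserving (fun z : ℝ × ℝ => z.1 - halfDiff K z + (if P then 1 else -1) * halfDiff K z)
      (μ.prod μ) μ := by
  split_ifs
  · convert (measurePreserving_fst : MeasurePreserving Prod.fst (μ.prod μ) μ) using 2 with z
    ring
  · convert measurePreserving_swap_bounded μ K using 2 with z
    ring

theorem integral_halfDiff_sq (μ : Measure ℝ) [IsProbabilityMeasure μ] {K : ℝ} (hK : 0 ≤ K) :
    ∫ z, halfDiff K z ^ 2 ∂(μ.prod μ) =
      ((∫ x in {x | |x| ≤ K}, x ^ 2 ∂μ) * μ.real {x | |x| ≤ K}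
        - (∫ x in {x | |x| ≤ K}, x ∂μ) ^ 2) / 2 := by
  set T := {x : ℝ | |x| ≤ K} with hT
  have hTm : MeasurableSet T := measurableSet_le (by fun_prop) (by fun_prop)
  set α : ℝ → ℝ := T.indicator fun x => x ^ 2
  set β : ℝ → ℝ := T.indicator fun _ => 1
  set γ : ℝ → ℝ := T.indicator fun x => x
  have hbdd : ∀ (f : ℝ → ℝ) (C : ℝ), Measurable f → (∀ x ∈ T, |f x| ≤ C) → 0 ≤ C →
      Integrable (T.indicator f) μ := by
    intro f C hf hfC hC
    refine Integrable.of_bound (hf.indicator hTm).aestronglyMeasurable C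
      (Filter.Eventually.of_forall fun x => ?_)
    by_cases hx : x ∈ T
    · simpa [hx] using hfC x hx
    · simpa [hx] using hC
  have hα : Integrable α μ := hbdd _ (K ^ 2) (by fun_prop)
    (fun x hx => by rw [abs_pow]; exact pow_le_pow_left₀ (abs_nonneg _) hx 2) (by positivity)
  have hβ : Integrable β μ := hbdd _ 1 (by fun_prop) (fun x hx => by simp) zero_le_one
  have hγ : Integrable γ μ := hbdd _ K (by fun_prop) (fun x hx => hx) hK
  have hd : ∀ z, halfDiff K z ^ 2
      = (α z.1 * β z.2 + β z.1 * α z.2 - 2 * (γ z.1 * γ z.2)) / 4 := by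
    intro z
    by_cases h1 : z.1 ∈ T <;> by_cases h2 : z.2 ∈ T
    · rw [halfDiff, if_pos ⟨h1, h2⟩]
      simp only [α, β, γ, Set.indicator_of_mem h1, Set.indicator_of_mem h2]
      ring
    · rw [halfDiff, if_neg (fun h => h2 h.2)]
      simp only [α, β, γ, Set.indicator_of_mem h1, Set.indicator_of_notMem h2]
      ring
    · rw [halfDiff, if_neg (fun h => h1 h.1)]
      simp only [α, β, γ, Set.indicator_of_notMem h1, Set.indicator_of_mem h2]
      ring
    · rw [halfDiff, if_neg (fun h => h1 h.1)]
      simp only [α, β, γ, Set.indicator_of_notMem h1, Set.indicator_of_notMem h2]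
      ring
  simp_rw [hd]
  have e0 : ∫ z : ℝ × ℝ, (α z.1 * β z.2 + β z.1 * α z.2 - 2 * (γ z.1 * γ z.2)) ∂(μ.prod μ)
      = ∫ z : ℝ × ℝ, α z.1 * β z.2 ∂(μ.prod μ) + ∫ z : ℝ × ℝ, β z.1 * α z.2 ∂(μ.prod μ)
        - 2 * ∫ z : ℝ × ℝ, γ z.1 * γ z.2 ∂(μ.prod μ) := by
    rw [← integral_const_mul, ← integral_add (hα.mul_prod hβ) (hβ.mul_prod hα)]
    exact integral_sub ((hα.mul_prod hβ).add (hβ.mul_prod hα)) ((hγ.mul_prod hγ).const_mul 2)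
  rw [integral_div, e0, integral_prod_mul, integral_prod_mul, integral_prod_mul]
  have e1 : ∫ x, α x ∂μ = ∫ x in T, x ^ 2 ∂μ := integral_indicator hTm
  have e2 : ∫ x, β x ∂μ = μ.real T := by
    rw [integral_indicator hTm]; simp
  have e3 : ∫ x, γ x ∂μ = ∫ x in T, x ∂μ := integral_indicator hTm
  rw [e1, e2, e3]
  ring

end Swap

/-! ### Small ball estimate for projections of a random vector -/

section SmallBall
open Module
variable {E : Type*} [NormedAddCommGroup E] [InnerProductSpace ℂ E] [FiniteDimensional ℂ E]

theorem sum_norm_sq_starProjection {ι : Type*} [Fintype ι] (b : OrthonormalBasis ι ℂ E)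
    (W : Submodule ℂ E) : ∑ a, ‖W.starProjection (b a)‖ ^ 2 = finrank ℂ W := by
  let c := stdOrthonormalBasis ℂ W
  have h1 : ∀ x : E, ‖W.starProjection x‖ ^ 2 = ∑ k, ‖inner ℂ (c k : E) x‖ ^ 2 := by
    intro x
    rw [Submodule.starProjection_apply, Submodule.norm_coe, ← c.sum_sq_norm_inner_right]
    refine Finset.sum_congr rfl fun k _ => ?_
    rw [Submodule.coe_inner, ← Submodule.starProjection_apply,
      ← Submodule.inner_starProjection_left_eq_right, Submodule.starProjection_eq_self_iff.2 (c k).2]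
  simp_rw [h1]
  rw [Finset.sum_comm]
  simp_rw [b.sum_sq_norm_inner_left]
  have h2 : ∀ k, ‖(c k : E)‖ = 1 := fun k => c.orthonormal.1 k
  simp [h2]

theorem sum_sq_inner_smul_starProjection_le {ι : Type*} [Fintype ι] (b : OrthonormalBasis ι ℂ E)
    (W : Submodule ℂ E) (t : ι → ℝ) (ht : ∀ a, |t a| ≤ 1 / 2) (w : E) :
    ∑ a, RCLike.re (inner ℂ (t a • W.starProjection (b a)) w) ^ 2 ≤ ‖w‖ ^ 2 / 4 := by
  have h1 : ∀ a, RCLike.re (inner ℂ (t a • W.starProjection (b a)) w) ^ 2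
      ≤ ‖inner ℂ (b a) (W.starProjection w)‖ ^ 2 / 4 := by
    intro a
    rw [← Complex.coe_smul, inner_smul_left, Complex.conj_ofReal, RCLike.re_to_complex,
      Complex.re_ofReal_mul, mul_pow, ← RCLike.re_to_complex,
      Submodule.inner_starProjection_left_eq_right]
    have h2 := RCLike.abs_re_le_norm (inner ℂ (b a) (W.starProjection w))
    have h3 : RCLike.re (inner ℂ (b a) (W.starProjection w)) ^ 2
        ≤ ‖inner ℂ (b a) (W.starProjection w)‖ ^ 2 := sq_le_sq.2 (by rwa [abs_norm])
    have h4 : t a ^ 2 ≤ 1 / 4 := by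
      have := pow_le_pow_left₀ (abs_nonneg _) (ht a) 2
      rw [sq_abs] at this
      linarith
    nlinarith [sq_nonneg (RCLike.re (inner ℂ (b a) (W.starProjection w)))]
  refine (Finset.sum_le_sum fun a _ => h1 a).trans ?_
  rw [← Finset.sum_div, b.sum_sq_norm_inner_right]
  have := W.norm_starProjection_apply_le w
  gcongr

theorem exp_neg_le_one_sub_half {t : ℝ} (h0 : 0 ≤ t) (h1 : t ≤ 1) : Real.exp (-t) ≤ 1 - t / 2 := by
  have h2 := Real.add_one_le_exp t
  have h3 : Real.exp (-t) * Real.exp t = 1 := by rw [← Real.exp_add]; simp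
  have h4 := Real.exp_pos (-t)
  nlinarith [mul_le_mul_of_nonneg_left h2 h4.le]

/-- Laplace transform of `‖W.starProjection X‖ ^ 2` for a random vector `X` with independent
coordinates `x a` in the orthonormal basis `b`. Each `x a` is realized as a midpoint plus a random
sign times `halfDiff`; given the pairs `(x a, x' a)`, the midpoints, unbounded coordinates included,
only shift the signed sum and so do no harm. -/
theorem integral_exp_neg_norm_sq_starProjection_le {ι : Type*} [Fintype ι]
    (μ : ι → Measure ℝ) [∀ a, IsProbabilityMeasure (μ a)] {K v : ℝ} (hK : 0 < K)
    (hv : ∀ a, v ≤ ∫ z, halfDiff K z ^ 2 ∂((μ a).prod (μ a)))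
    (b : OrthonormalBasis ι ℂ E) (W : Submodule ℂ E) :
    ∫ x : ι → ℝ, Real.exp (-‖∑ a, (x a / (2 * K)) • W.starProjection (b a)‖ ^ 2)
        ∂(Measure.pi μ)
      ≤ Real.exp (-(v * finrank ℂ W / (16 * K ^ 2))) := by
  classical
  let : InnerProductSpace ℝ E := InnerProductSpace.rclikeToReal ℂ E
  set f : ι → E := fun a => W.starProjection (b a) with hf
  set F : (ι → ℝ) → ℝ := fun x => Real.exp (-‖∑ a, (x a / (2 * K)) • f a‖ ^ 2) with hF
  have hFc : Continuous F := by fun_prop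
  set ν := Measure.pi fun a => (μ a).prod (μ a) with hν
  let Φ : Finset ι → (ι → ℝ × ℝ) → ι → ℝ := fun ε z a =>
    (z a).1 - halfDiff K (z a) + (if a ∈ ε then 1 else -1) * halfDiff K (z a)
  have hΦ : ∀ ε, MeasurePreserving (Φ ε) ν (Measure.pi μ) := fun ε =>
    measurePreserving_pi _ _ fun a => measurePreserving_add_sign_halfDiff (μ a) K (a ∈ ε)
  have hint : ∀ ε, Integrable (fun z => F (Φ ε z)) ν := fun ε => by
    refine Integrable.of_bound
      (hFc.measurable.comp (hΦ ε).measurable).aestronglyMeasurable 1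
      (Filter.Eventually.of_forall fun z => ?_)
    rw [Real.norm_eq_abs, Real.abs_exp, Real.exp_le_one_iff]
    exact neg_nonpos.2 (sq_nonneg _)
  have heq : ∀ ε, ∫ z, F (Φ ε z) ∂ν = ∫ x, F x ∂(Measure.pi μ) := fun ε => by
    rw [← (hΦ ε).map_eq, integral_map (hΦ ε).measurable.aemeasurable
      hFc.aestronglyMeasurable]
  set G : ι → ℝ × ℝ → ℝ := fun a z =>
    Real.exp (-(halfDiff K z ^ 2 * ‖f a‖ ^ 2 / (8 * K ^ 2))) with hG
  have hpt : ∀ z : ι → ℝ × ℝ, ∑ ε, F (Φ ε z) ≤ 2 ^ Fintype.card ι * ∏ a, G a (z a) := by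
    intro z
    have ht : ∀ a, |halfDiff K (z a) / (2 * K)| ≤ 1 / 2 := fun a => by
      rw [abs_div, abs_of_pos (by positivity : 0 < 2 * K), div_le_iff₀ (by positivity)]
      linarith [abs_halfDiff_le hK.le (z a)]
    have h := sum_exp_neg_norm_sq_signs_le _ (sum_sq_inner_smul_starProjection_le b W _ ht)
      (∑ a, (((z a).1 - halfDiff K (z a)) / (2 * K)) • f a)
    have e1 : ∀ ε, F (Φ ε z) = Real.exp (-‖∑ a, (((z a).1 - halfDiff K (z a)) / (2 * K)) • f a
        + ∑ a, (if a ∈ ε then (1 : ℝ) else -1) • (halfDiff K (z a) / (2 * K)) • f a‖ ^ 2) := by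
      intro ε
      rw [← Finset.sum_add_distrib, hF]
      simp only [Φ]
      congr 4
      refine Finset.sum_congr rfl fun a _ => ?_
      rw [smul_smul, ← add_smul]
      congr 1
      ring
    have e2 : ∏ a, G a (z a)
        = Real.exp (-∑ a, ‖(halfDiff K (z a) / (2 * K)) • f a‖ ^ 2 / 2) := by
      rw [hG, ← Real.exp_sum, Finset.sum_neg_distrib]
      congr 2
      refine Finset.sum_congr rfl fun a _ => ?_
      rw [norm_smul, mul_pow, Real.norm_eq_abs, sq_abs]
      field_simp
      norm_num
    rw [Finset.sum_congr rfl fun ε _ => e1 ε, e2]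
    exact h
  have hGm : ∀ a, Measurable (G a) := fun a => by
    have := measurable_halfDiff K
    fun_prop
  have hGi : ∀ a, Integrable (G a) ((μ a).prod (μ a)) := fun a => by
    refine Integrable.of_bound (hGm a).aestronglyMeasurable 1
      (Filter.Eventually.of_forall fun z => ?_)
    rw [Real.norm_eq_abs, Real.abs_exp, Real.exp_le_one_iff]
    exact neg_nonpos.2 (by positivity)
  have hdi : ∀ a, Integrable (fun z => halfDiff K z ^ 2) ((μ a).prod (μ a)) := fun a => by
    refine Integrable.of_bound ((measurable_halfDiff K).pow_const 2).aestronglyMeasurable (K ^ 2)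
      (Filter.Eventually.of_forall fun z => ?_)
    rw [norm_pow]
    exact pow_le_pow_left₀ (norm_nonneg _) (abs_halfDiff_le hK.le z) 2
  have hfa : ∀ a, ‖f a‖ ≤ 1 := fun a =>
    (W.norm_starProjection_apply_le (b a)).trans (b.orthonormal.1 a).le
  have hG1 : ∀ a, ∫ z, G a z ∂((μ a).prod (μ a))
      ≤ Real.exp (-(v * ‖f a‖ ^ 2 / (16 * K ^ 2))) := by
    intro a
    have h1 : ∀ z, G a z ≤ 1 - halfDiff K z ^ 2 * (‖f a‖ ^ 2 / (16 * K ^ 2)) := by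
      intro z
      refine (exp_neg_le_one_sub_half (by positivity) ?_).trans_eq ?_
      · rw [div_le_one (by positivity)]
        have h1 := pow_le_pow_left₀ (abs_nonneg _) (abs_halfDiff_le hK.le z) 2
        rw [sq_abs] at h1
        have h2 := pow_le_pow_left₀ (norm_nonneg _) (hfa a) 2
        rw [one_pow] at h2
        nlinarith [sq_nonneg (halfDiff K z), mul_pos hK hK]
      · field_simp; ring
    refine (integral_mono (hGi a) ((integrable_const _).sub ((hdi a).mul_const _)) h1).trans ?_
    refine (integral_sub (integrable_const _) ((hdi a).mul_const _)).trans_le ?_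
    rw [integral_mul_const]
    simp only [integral_const, probReal_univ, smul_eq_mul, mul_one]
    refine (Real.one_sub_le_exp_neg _).trans ?_
    rw [Real.exp_le_exp, neg_le_neg_iff, mul_div_assoc]
    exact mul_le_mul_of_nonneg_right (hv a) (by positivity)
  have hprod : ∫ z, ∏ a, G a (z a) ∂ν
      ≤ Real.exp (-(v * finrank ℂ W / (16 * K ^ 2))) := by
    rw [hν, integral_fintype_prod_eq_prod]
    refine (Finset.prod_le_prod (fun a _ => integral_nonneg fun z => (Real.exp_pos _).le)
      fun a _ => hG1 a).trans_eq ?_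
    rw [← Real.exp_sum, Finset.sum_neg_distrib, ← Finset.sum_div, ← Finset.mul_sum,
      sum_norm_sq_starProjection]
  have h2 : (2 : ℝ) ^ Fintype.card ι * ∫ x, F x ∂(Measure.pi μ)
      ≤ 2 ^ Fintype.card ι * ∫ z, ∏ a, G a (z a) ∂ν := by
    calc _ = ∑ ε : Finset ι, ∫ z, F (Φ ε z) ∂ν := by
          rw [Finset.sum_congr rfl fun ε _ => heq ε]; simp
      _ = ∫ z, ∑ ε, F (Φ ε z) ∂ν := (integral_finsetSum _ fun ε _ => hint ε).symm
      _ ≤ ∫ z, 2 ^ Fintype.card ι * ∏ a, G a (z a) ∂ν :=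
          integral_mono (integrable_finsetSum _ fun ε _ => hint ε)
            ((Integrable.fintype_prod hGi).const_mul _) hpt
      _ = _ := integral_const_mul _ _
  exact (le_of_mul_le_mul_left h2 (by positivity)).trans hprod

/-- Markov's inequality for `integral_exp_neg_norm_sq_starProjection_le`. -/
theorem measureReal_norm_starProjection_lt_le {ι : Type*} [Fintype ι]
    (μ : ι → Measure ℝ) [∀ a, IsProbabilityMeasure (μ a)] {K v : ℝ} (hK : 0 < K)
    (hv : ∀ a, v ≤ ∫ z, halfDiff K z ^ 2 ∂((μ a).prod (μ a)))
    (b : OrthonormalBasis ι ℂ E) (W : Submodule ℂ E) {τ : ℝ} :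
    (Measure.pi μ).real {x | ‖W.starProjection (∑ a, (x a : ℂ) • b a)‖ < τ}
      ≤ Real.exp (τ ^ 2 / (4 * K ^ 2)
        - v * finrank ℂ W / (16 * K ^ 2)) := by
  set F : (ι → ℝ) → ℝ := fun x =>
    Real.exp (-‖∑ a, (x a / (2 * K)) • W.starProjection (b a)‖ ^ 2) with hF
  have hFc : Continuous F := by fun_prop
  have hFi : Integrable F (Measure.pi μ) := by
    refine Integrable.of_bound hFc.aestronglyMeasurable 1
      (Filter.Eventually.of_forall fun z => ?_)
    rw [Real.norm_eq_abs, Real.abs_exp, Real.exp_le_one_iff]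
    exact neg_nonpos.2 (sq_nonneg _)
  have hsub : {x : ι → ℝ | ‖W.starProjection (∑ a, (x a : ℂ) • b a)‖ < τ}
      ⊆ {x | Real.exp (-(τ ^ 2 / (4 * K ^ 2))) ≤ F x} := by
    intro x hx
    have h1 : ∑ a, (x a / (2 * K)) • W.starProjection (b a)
        = (2 * K)⁻¹ • W.starProjection (∑ a, (x a : ℂ) • b a) := by
      rw [map_sum, Finset.smul_sum]
      refine Finset.sum_congr rfl fun a _ => ?_
      rw [map_smul, Complex.coe_smul, smul_smul, div_eq_inv_mul]
    simp only [Set.mem_ofPred_eq, hF]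
    rw [h1, norm_smul, mul_pow, norm_inv, Real.norm_eq_abs, inv_pow, sq_abs]
    have h2 := pow_le_pow_left₀ (norm_nonneg _) hx.le 2
    gcongr
    rw [div_eq_inv_mul]
    have : (2 * K) ^ 2 = 4 * K ^ 2 := by ring
    rw [this]
    gcongr
  have h1 := mul_meas_ge_le_integral_of_nonneg
    (Filter.Eventually.of_forall fun x => (Real.exp_pos _).le) hFi
    (Real.exp (-(τ ^ 2 / (4 * K ^ 2))))
  have h2 := integral_exp_neg_norm_sq_starProjection_le μ hK hv b W
  have h3 := measureReal_mono (μ := Measure.pi μ) hsub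
  refine h3.trans ?_
  have h4 := h1.trans h2
  rw [sub_eq_add_neg, Real.exp_add]
  calc _ = Real.exp (τ ^ 2 / (4 * K ^ 2)) * (Real.exp (-(τ ^ 2 / (4 * K ^ 2))) *
        (Measure.pi μ).real {x | Real.exp (-(τ ^ 2 / (4 * K ^ 2))) ≤ F x}) := by
        rw [← mul_assoc, ← Real.exp_add, add_neg_cancel, Real.exp_zero, one_mul]
    _ ≤ _ := by gcongr

end SmallBall

/-! ### Independence and truncated moments of the sparse entries -/

section Independence

/-- If the `X i j` are independent, then so are the rows `(X i j)_j`; a converse of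
`ProbabilityTheory.iIndepFun_uncurry'`. -/
theorem iIndepFun_curry {Ω ι κ : Type*} [MeasurableSpace Ω] {P : Measure Ω} {X : ι → κ → Ω → ℝ}
    (hX : ∀ i j, Measurable (X i j)) (h : iIndepFun (fun p : ι × κ => X p.1 p.2) P) :
    iIndepFun (fun i ω j => X i j ω) P := by
  have := h.isProbabilityMeasure
  have : ∀ i j, IsProbabilityMeasure (P.map (X i j)) :=
    fun i j => Measure.isProbabilityMeasure_map (hX i j).aemeasurable
  have h' : iIndepFun (fun (p : (_ : ι) × κ) ω => X p.1 p.2 ω) P :=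
    h.precomp (g := Equiv.sigmaEquivProd ι κ) (Equiv.injective _)
  have hrow : ∀ i, iIndepFun (X i) P := fun i =>
    h.precomp (g := fun j => (i, j)) (Prod.mk_right_injective i)
  have e : (fun ω i j => X i j ω)
      = (MeasurableEquiv.piCurry fun (_ : ι) (_ : κ) => ℝ) ∘
        (fun ω (p : (_ : ι) × κ) => X p.1 p.2 ω) := by
    ext; simp [Sigma.curry]
  rw [iIndepFun_iff_map_fun_eq_infinitePi_map (by fun_prop), e,
    ← Measure.map_map (by fun_prop) (by fun_prop),
    (iIndepFun_iff_map_fun_eq_infinitePi_map (by fun_prop)).1 h',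
    Measure.infinitePi_map_piCurry (fun i j => P.map (X i j))]
  congr 1
  ext1 i
  rw [(iIndepFun_iff_map_fun_eq_infinitePi_map (by fun_prop)).1 (hrow i)]

variable {Ω : Type*} [MeasurableSpace Ω] {P : Measure Ω} {n : ℕ} {ξ δ : Fin n → Fin n → Ω → ℝ}
  {p : ℝ}

theorem IsSparseArray.iIndepFun_mul (h : IsSparseArray P ξ δ p) :
    iIndepFun (fun (e : Fin n × Fin n) ω => ξ e.1 e.2 ω * δ e.1 e.2 ω) P := by
  -- Reindexing by entry and by family (`true` for `ξ`) makes the pairs `(ξ e, δ e)` rows of an array.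
  let g : (Fin n × Fin n) × Bool → (Fin n × Fin n) ⊕ (Fin n × Fin n) :=
    fun q => if q.2 then Sum.inl q.1 else Sum.inr q.1
  have hg : Function.Injective g := by
    rintro ⟨e, b⟩ ⟨e', b'⟩ hq
    cases b <;> cases b' <;> simp_all [g]
  let Y : Fin n × Fin n → Bool → Ω → ℝ := fun e b => if b then ξ e.1 e.2 else δ e.1 e.2
  have hY : iIndepFun (fun q : (Fin n × Fin n) × Bool => Y q.1 q.2) P := by
    convert h.indep.precomp hg using 2 with q
    obtain ⟨e, b⟩ := q
    cases b <;> rfl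
  have hYm : ∀ e b, Measurable (Y e b) := by
    intro e b
    cases b
    · exact h.measurable_delta _ _
    · exact h.measurable_xi _ _
  exact (iIndepFun_curry hYm hY).comp (fun _ y => y true * y false) (fun _ => by fun_prop)

theorem IsSparseArray.measurable_mul (h : IsSparseArray P ξ δ p) (i j : Fin n) :
    Measurable fun ω => ξ i j ω * δ i j ω :=
  (h.measurable_xi i j).mul (h.measurable_delta i j)

theorem IsSparseArray.map_row_eq_pi (h : IsSparseArray P ξ δ p) (i : Fin n) :
    P.map (fun ω j => ξ i j ω * δ i j ω)
      = Measure.pi fun j => P.map fun ω => ξ i j ω * δ i j ω := by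
  have h1 := h.iIndepFun_mul.precomp (g := fun j => (i, j)) (Prod.mk_right_injective i)
  exact h1.map_fun_eq_pi_map fun j => (h.measurable_mul i j).aemeasurable

theorem IsSparseArray.indepFun_row_compl (h : IsSparseArray P ξ δ p) (i : Fin n) :
    IndepFun (fun ω j => ξ i j ω * δ i j ω)
      (fun ω (l : ({i}ᶜ : Finset (Fin n))) j => ξ l j ω * δ l j ω) P := by
  have h1 := iIndepFun_curry (X := fun i j ω => ξ i j ω * δ i j ω) h.measurable_mul h.iIndepFun_mul
  have h2 := h1.indepFun_finset {i} {i}ᶜ disjoint_compl_right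
    (fun l => measurable_pi_lambda _ fun j => h.measurable_mul l j)
  exact h2.comp (φ := fun x : (({i} : Finset (Fin n)) → Fin n → ℝ) =>
    x ⟨i, Finset.mem_singleton_self i⟩) (ψ := id) (by fun_prop) measurable_id

theorem IsSparseArray.indepFun_entry (h : IsSparseArray P ξ δ p) (i j : Fin n) :
    IndepFun (ξ i j) (δ i j) P :=
  h.indep.indepFun (i := Sum.inl (i, j)) (j := Sum.inr (i, j)) Sum.inl_ne_inr

theorem IsSparseArray.delta_ae [IsProbabilityMeasure P] (h : IsSparseArray P ξ δ p)
    (i j : Fin n) : ∀ᵐ ω ∂P, δ i j ω = 0 ∨ δ i j ω = 1 := by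
  have hm0 : MeasurableSet {ω | δ i j ω = 0} :=
    measurableSet_eq_fun (h.measurable_delta i j) measurable_const
  have hm1 : MeasurableSet {ω | δ i j ω = 1} :=
    measurableSet_eq_fun (h.measurable_delta i j) measurable_const
  have hd : Disjoint {ω | δ i j ω = 0} {ω | δ i j ω = 1} := by
    rw [Set.disjoint_left]
    intro ω h0 h1
    rw [Set.mem_ofPred_eq] at h0 h1
    linarith
  have h1 : P.real ({ω | δ i j ω = 0} ∪ {ω | δ i j ω = 1}) = 1 := by
    rw [measureReal_union hd hm1, h.delta_zero, h.delta_one]; ring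
  have h2 := (prob_compl_eq_zero_iff (hm0.union hm1)).2
    (by rw [← ofReal_measureReal (μ := P), h1, ENNReal.ofReal_one])
  rw [ae_iff]
  exact h2

theorem IsSparseArray.integral_delta [IsProbabilityMeasure P] (h : IsSparseArray P ξ δ p)
    (i j : Fin n) : ∫ ω, δ i j ω ∂P = p := by
  have hm1 : MeasurableSet {ω | δ i j ω = 1} :=
    measurableSet_eq_fun (h.measurable_delta i j) measurable_const
  have h1 : δ i j =ᵐ[P] {ω | δ i j ω = 1}.indicator 1 := by
    filter_upwards [h.delta_ae i j] with ω hω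
    rcases hω with h0 | h0
    · rw [Set.indicator_of_notMem, h0]
      rw [Set.mem_ofPred_eq]; linarith
    · rw [Set.indicator_of_mem (by exact h0), h0]; rfl
  rw [integral_congr_ae h1, integral_indicator_one hm1, h.delta_one]

theorem IsSparseArray.integral_sq [IsProbabilityMeasure P] (h : IsSparseArray P ξ δ p)
    (i j : Fin n) : ∫ ω, ξ i j ω ^ 2 ∂P = 1 := by
  have h1 := variance_eq_sub (h.memLp_xi i j)
  rw [h.variance_xi, h.mean_xi] at h1
  simpa using h1.symm

/-- Since `δ i j` takes the values `0` and `1` only, `f (ξ * δ) = f ξ * δ` whenever `f 0 = 0`. -/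
theorem IsSparseArray.integral_comp_mul [IsProbabilityMeasure P] (h : IsSparseArray P ξ δ p)
    (i j : Fin n) {f : ℝ → ℝ} (hf : Measurable f) (hf0 : f 0 = 0) :
    ∫ ω, f (ξ i j ω * δ i j ω) ∂P = (∫ ω, f (ξ i j ω) ∂P) * p := by
  have h1 : (fun ω => f (ξ i j ω * δ i j ω)) =ᵐ[P] fun ω => f (ξ i j ω) * δ i j ω := by
    filter_upwards [h.delta_ae i j] with ω hω
    rcases hω with h0 | h0 <;> simp [h0, hf0]
  rw [integral_congr_ae h1, ← h.integral_delta i j]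
  exact ((h.indepFun_entry i j).comp hf measurable_id).integral_fun_mul_eq_mul_integral
    (hf.comp (h.measurable_xi i j)).aestronglyMeasurable
    (h.measurable_delta i j).aestronglyMeasurable

/-- Lower bound for the truncated variance of the entries, of the order of `p`. -/
theorem IsSparseArray.le_integral_halfDiff_sq [IsProbabilityMeasure P]
    (h : IsSparseArray P ξ δ p) (hp0 : 0 ≤ p) (hp1 : p ≤ 1) {K : ℝ} (hK : 1 ≤ K) (i j : Fin n)
    (htail : ∫ ω in {ω | K < |ξ i j ω|}, ξ i j ω ^ 2 ∂P ≤ 1 / 4) :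
    p / 4 ≤ ∫ z, halfDiff K z ^ 2
      ∂((P.map fun ω => ξ i j ω * δ i j ω).prod (P.map fun ω => ξ i j ω * δ i j ω)) := by
  have hXm := h.measurable_mul i j
  have hξm := h.measurable_xi i j
  have := Measure.isProbabilityMeasure_map (μ := P) hXm.aemeasurable
  rw [integral_halfDiff_sq _ (zero_le_one.trans hK)]
  set T := {x : ℝ | |x| ≤ K} with hT
  have hTm : MeasurableSet T := measurableSet_le (by fun_prop) (by fun_prop)
  have hAm : MeasurableSet {ω | K < |ξ i j ω|} := measurableSet_lt (by fun_prop) (by fun_prop)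
  have hAc : {ω | K < |ξ i j ω|}ᶜ = ξ i j ⁻¹' T := by
    ext ω; simp [hT]
  have hint2 : Integrable (fun ω => ξ i j ω ^ 2) P := (h.memLp_xi i j).integrable_sq
  have hint1 : Integrable (ξ i j) P := (h.memLp_xi i j).integrable one_le_two
  -- On the event that `ξ` exceeds `K ≥ 1`, both `1` and `|ξ|` are at most `ξ ^ 2`.
  have hprob : P.real {ω | K < |ξ i j ω|} ≤ 1 / 4 := by
    refine le_trans ?_ htail
    have h1 : P.real {ω | K < |ξ i j ω|} = ∫ _ in {ω | K < |ξ i j ω|}, (1 : ℝ) ∂P := by simp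
    rw [h1]
    refine setIntegral_mono_on (integrable_const _).integrableOn hint2.integrableOn hAm
      fun ω hω => ?_
    have : 1 < |ξ i j ω| := hK.trans_lt hω
    rw [← sq_abs]; nlinarith
  have hmean : |∫ ω in {ω | K < |ξ i j ω|}, ξ i j ω ∂P| ≤ 1 / 4 := by
    refine le_trans (abs_integral_le_integral_abs.trans ?_) htail
    refine setIntegral_mono_on hint1.abs.integrableOn hint2.integrableOn hAm fun ω hω => ?_
    have : 1 < |ξ i j ω| := hK.trans_lt hω
    rw [← sq_abs]; nlinarith
  have htrunc : ∀ f : ℝ → ℝ, Measurable f → f 0 = 0 →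
      ∫ x in T, f x ∂(P.map fun ω => ξ i j ω * δ i j ω)
        = (∫ ω in ξ i j ⁻¹' T, f (ξ i j ω) ∂P) * p := by
    intro f hf hf0
    have hfm : Measurable (T.indicator f) := hf.indicator hTm
    rw [← integral_indicator hTm, integral_map hXm.aemeasurable hfm.aestronglyMeasurable,
      h.integral_comp_mul i j hfm (by simp [Set.indicator, hf0]),
      ← integral_indicator (hξm hTm)]
    rfl
  have e1 : ∫ x in T, x ^ 2 ∂(P.map fun ω => ξ i j ω * δ i j ω) ≥ 3 / 4 * p := by
    rw [htrunc (fun x => x ^ 2) (by fun_prop) (by norm_num), ← hAc]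
    have h1 := integral_add_compl hAm hint2
    rw [h.integral_sq] at h1
    exact mul_le_mul_of_nonneg_right (by linarith) hp0
  have e2 : |∫ x in T, x ∂(P.map fun ω => ξ i j ω * δ i j ω)| ≤ 1 / 4 * p := by
    rw [htrunc (fun x => x) (by fun_prop) rfl, ← hAc, abs_mul, abs_of_nonneg hp0]
    have h1 := integral_add_compl hAm hint1
    rw [h.mean_xi] at h1
    rw [eq_neg_of_add_eq_zero_right h1, abs_neg]
    exact mul_le_mul_of_nonneg_right hmean hp0
  have e3 : 3 / 4 ≤ (P.map fun ω => ξ i j ω * δ i j ω).real T := by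
    rw [map_measureReal_apply hXm hTm]
    have h1 : 3 / 4 ≤ P.real {ω | K < |ξ i j ω|}ᶜ := by
      rw [probReal_compl_eq_one_sub hAm]; linarith
    refine h1.trans (ENNReal.toReal_mono (measure_ne_top _ _) (measure_mono_ae ?_))
    filter_upwards [h.delta_ae i j] with ω hω hA
    have hA' : |ξ i j ω| ≤ K := not_lt.1 hA
    change |ξ i j ω * δ i j ω| ≤ K
    rcases hω with h0 | h0
    · rw [h0, mul_zero, abs_zero]; linarith
    · rwa [h0, mul_one]
  have e4 := pow_le_pow_left₀ (abs_nonneg _) e2 2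
  rw [sq_abs] at e4
  have e5 := mul_le_mul e1 e3 (by norm_num) (le_trans (by positivity) e1)
  nlinarith

end Independence

/-! ### A truncation level determined by the tail -/

section Tail

universe u

/-- One truncation level `K` serves all variables `ξ` with the given tail, on all probability spaces.
If no square integrable `ξ` has this tail, any `K` will do. -/
theorem exists_truncation_level (tail : ℝ → ℝ) :
    ∃ K : ℝ, 1 ≤ K ∧ ∀ {Ω : Type u} [MeasurableSpace Ω] (P : Measure Ω) [IsProbabilityMeasure P]
      (ξ : Ω → ℝ), Measurable ξ → MemLp ξ 2 P →
      (∀ t : ℝ, 0 ≤ t → P.real {ω | t < |ξ ω|} = tail t) →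
      ∫ ω in {ω | K < |ξ ω|}, ξ ω ^ 2 ∂P ≤ 1 / 4 := by
  by_cases hex : ∃ (Ω : Type u) (_ : MeasurableSpace Ω) (P : Measure Ω) (_ : IsProbabilityMeasure P)
      (ξ : Ω → ℝ), Measurable ξ ∧ MemLp ξ 2 P ∧
      (∀ t : ℝ, 0 ≤ t → P.real {ω | t < |ξ ω|} = tail t)
  swap
  · refine ⟨1, le_rfl, fun {Ω} _ P _ ξ h1 h2 h3 => (hex ⟨Ω, _, P, ‹_›, ξ, h1, h2, h3⟩).elim⟩
  obtain ⟨Ω₀, _, P₀, _, ξ₀, hm₀, hL₀, ht₀⟩ := hex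
  have hset : ∀ {Ω : Type u} [MeasurableSpace Ω] (P : Measure Ω) (ξ : Ω → ℝ), Measurable ξ →
      ∀ K : ℝ, ∫ ω in {ω | K < |ξ ω|}, ξ ω ^ 2 ∂P
        = ∫ y in Set.Ioi K, y ^ 2 ∂(P.map fun ω => |ξ ω|) := by
    intro Ω _ P ξ hξ K
    rw [setIntegral_map measurableSet_Ioi (by fun_prop) (by fun_prop)]
    simp only [sq_abs]
    rfl
  -- The law of `|ξ|` is determined by the tail.
  have hlaw : ∀ {Ω : Type u} [MeasurableSpace Ω] (P : Measure Ω) [IsProbabilityMeasure P]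
      (ξ : Ω → ℝ), Measurable ξ → (∀ t : ℝ, 0 ≤ t → P.real {ω | t < |ξ ω|} = tail t) →
      P.map (fun ω => |ξ ω|) = P₀.map (fun ω => |ξ₀ ω|) := by
    have haux : ∀ {Ω : Type u} [MeasurableSpace Ω] (P : Measure Ω) [IsProbabilityMeasure P]
        (ξ : Ω → ℝ), Measurable ξ → (∀ t : ℝ, 0 ≤ t → P.real {ω | t < |ξ ω|} = tail t) →
        ∀ a : ℝ, P.map (fun ω => |ξ ω|) (Set.Iic a)
          = if 0 ≤ a then ENNReal.ofReal (1 - tail a) else 0 := by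
      intro Ω _ P _ ξ hξ ht a
      rw [Measure.map_apply (by fun_prop) measurableSet_Iic]
      split_ifs with ha
      · have hm : MeasurableSet {ω | a < |ξ ω|} := measurableSet_lt (by fun_prop) (by fun_prop)
        rw [← ht a ha, ← probReal_compl_eq_one_sub hm, ofReal_measureReal]
        congr 1
        ext ω; simp
      · convert measure_empty (μ := P)
        ext ω
        simp only [Set.mem_preimage, Set.mem_Iic, Set.mem_empty_iff_false, iff_false, not_le]
        exact (not_le.1 ha).trans_le (abs_nonneg _)
    intro Ω _ P _ ξ hξ ht
    have := Measure.isProbabilityMeasure_map (μ := P) (f := fun ω => |ξ ω|) (by fun_prop)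
    refine Measure.ext_of_Iic _ _ fun a => ?_
    rw [haux P ξ hξ ht, haux P₀ ξ₀ hm₀ ht₀]
  have hint : Integrable (fun ω => ξ₀ ω ^ 2) P₀ := hL₀.integrable_sq
  have hlim := tendsto_setIntegral_of_antitone (μ := P₀) (f := fun ω => ξ₀ ω ^ 2)
    (s := fun m : ℕ => {ω | (m : ℝ) < |ξ₀ ω|})
    (fun m => measurableSet_lt (by fun_prop) (by fun_prop))
    (fun a b hab ω (hω : (b : ℝ) < |ξ₀ ω|) =>
      show (a : ℝ) < |ξ₀ ω| from lt_of_le_of_lt (Nat.cast_le.2 hab) hω) ⟨0, hint.integrableOn⟩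
  have hempty : ⋂ m : ℕ, {ω | (m : ℝ) < |ξ₀ ω|} = ∅ := by
    ext ω
    simp only [Set.mem_iInter, Set.mem_ofPred_eq, Set.mem_empty_iff_false, iff_false, not_forall,
      not_lt]
    exact exists_nat_ge _
  rw [hempty, setIntegral_empty] at hlim
  obtain ⟨m, hm1, hm2⟩ := ((hlim.eventually_le_const (by norm_num : (0 : ℝ) < 1 / 4)).and
    (Filter.eventually_ge_atTop 1)).exists
  refine ⟨m, by exact_mod_cast hm2, fun {Ω} _ P _ ξ hξ _ ht => ?_⟩
  rw [hset P ξ hξ, hlaw P ξ hξ ht, ← hset P₀ ξ₀ hm₀]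
  exact hm1

end Tail

/-! ### Distance to an independent random subspace -/

section RandomSubspace
open Module
variable {E : Type*} [NormedAddCommGroup E] [InnerProductSpace ℂ E] [FiniteDimensional ℂ E]

/-- A random vector with independent coordinates is unlikely to be close to a random subspace that is
independent of it and of codimension at least `k`. The subspace is spanned by the `g l (Y ω)`, and
closeness is expressed by the existence of the coefficients `c` of a nearby point. -/
theorem measureReal_exists_norm_sub_lt_le {Ω ι κ β : Type*} [MeasurableSpace Ω] [Fintype ι]
    [Fintype κ] [TopologicalSpace β] [SecondCountableTopology β] [MeasurableSpace β]
    [BorelSpace β] {P : Measure Ω} [IsProbabilityMeasure P]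
    (μ : ι → Measure ℝ) [∀ a, IsProbabilityMeasure (μ a)] {K v : ℝ} (hK : 0 < K) (hv0 : 0 ≤ v)
    (hv : ∀ a, v ≤ ∫ z, halfDiff K z ^ 2 ∂((μ a).prod (μ a)))
    (b : OrthonormalBasis ι ℂ E) {X : Ω → ι → ℝ} {Y : Ω → β} (hX : Measurable X)
    (hY : Measurable Y) (hlaw : P.map X = Measure.pi μ) (hXY : IndepFun X Y P)
    {g : κ → β → E} (hg : ∀ l, Continuous (g l)) {k : ℕ}
    (hk : Fintype.card κ + k ≤ Fintype.card ι) (τ : ℝ) :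
    P.real {ω | ∃ c : κ → ℂ, ‖∑ a, (X ω a : ℂ) • b a - ∑ l, c l • g l (Y ω)‖ < τ}
      ≤ Real.exp (τ ^ 2 / (4 * K ^ 2) - v * k / (16 * K ^ 2)) := by
  set D : Set ((ι → ℝ) × β) :=
    {q | ∃ c : κ → ℂ, ‖∑ a, (q.1 a : ℂ) • b a - ∑ l, c l • g l q.2‖ < τ} with hD
  -- Measurability comes for free: `D` is a union of open sets, one for each `c`.
  have hDo : IsOpen D := by
    have : D = ⋃ c : κ → ℂ, {q | ‖∑ a, (q.1 a : ℂ) • b a - ∑ l, c l • g l q.2‖ < τ} := by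
      ext q; simp [hD]
    rw [this]
    refine isOpen_iUnion fun c => isOpen_lt ?_ continuous_const
    have : ∀ l, Continuous fun q : (ι → ℝ) × β => g l q.2 := fun l => (hg l).comp continuous_snd
    fun_prop
  have hDm : MeasurableSet D := hDo.measurableSet
  set C := Real.exp (τ ^ 2 / (4 * K ^ 2) - v * k / (16 * K ^ 2)) with hC
  have hslice : ∀ y : β, Measure.pi μ ((fun x => (x, y)) ⁻¹' D) ≤ ENNReal.ofReal C := by
    intro y
    set H : Submodule ℂ E := Submodule.span ℂ (Set.range fun l => g l y) with hH
    have hfin : (k : ℝ) ≤ finrank ℂ Hᗮ := by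
      have h1 : finrank ℂ H ≤ Fintype.card κ := finrank_range_le_card _
      have h2 := H.finrank_add_finrank_orthogonal
      rw [finrank_eq_card_basis b.toBasis] at h2
      exact_mod_cast (by omega : k ≤ finrank ℂ Hᗮ)
    have hsub : (fun x => (x, y)) ⁻¹' D
        ⊆ {x | ‖(Hᗮ).starProjection (∑ a, (x a : ℂ) • b a)‖ < τ} := by
      rintro x ⟨c, hc⟩
      refine lt_of_le_of_lt ?_ hc
      have h1 : ∑ l, c l • g l y ∈ H :=
        Submodule.sum_mem _ fun l _ => Submodule.smul_mem _ _ (Submodule.subset_span ⟨l, rfl⟩)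
      have h2 : (Hᗮ).starProjection (∑ l, c l • g l y) = 0 :=
        Submodule.starProjection_apply_eq_zero_iff _ |>.2 (Submodule.le_orthogonal_orthogonal H h1)
      have h3 := (Hᗮ).norm_starProjection_apply_le
        (∑ a, (x a : ℂ) • b a - ∑ l, c l • g l y)
      rwa [map_sub, h2, sub_zero] at h3
    refine (measure_mono hsub).trans ?_
    rw [← ofReal_measureReal]
    refine ENNReal.ofReal_le_ofReal ((measureReal_norm_starProjection_lt_le μ hK hv b _).trans ?_)
    rw [hC]
    gcongr
  have hev : {ω | ∃ c : κ → ℂ, ‖∑ a, (X ω a : ℂ) • b a - ∑ l, c l • g l (Y ω)‖ < τ}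
      = (fun ω => (X ω, Y ω)) ⁻¹' D := rfl
  have hYp : IsProbabilityMeasure (P.map Y) := Measure.isProbabilityMeasure_map hY.aemeasurable
  have hle : P ((fun ω => (X ω, Y ω)) ⁻¹' D) ≤ ENNReal.ofReal C := by
    rw [← Measure.map_apply (hX.prodMk hY) hDm,
      (indepFun_iff_map_prod_eq_prod_map_map hX.aemeasurable hY.aemeasurable).1 hXY, hlaw,
      Measure.prod_apply_symm hDm]
    refine (lintegral_mono hslice).trans ?_
    simp
  rw [hev]
  exact ENNReal.toReal_le_of_le_ofReal (Real.exp_pos _).le hle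

end RandomSubspace

/-! ### Distance from a row to the span of other rows -/

section Rows

/-- With `s = √(n * p)`, the complex conjugate of row `l` of `s • shiftedMatrix ξ δ p w`, where `x`
is row `l` of the array `ξ i j * δ i j`. The conjugate makes the entries of the matrix times a vector
inner products with the rows. -/
noncomputable def conjRow {n : ℕ} (s : ℝ) (w : ℂ) (l : Fin n) (x : Fin n → ℝ) :
    EuclideanSpace ℂ (Fin n) :=
  ∑ a, (x a : ℂ) • EuclideanSpace.basisFun (Fin n) ℂ a
    - (s * starRingEnd ℂ w) • EuclideanSpace.basisFun (Fin n) ℂ l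

theorem continuous_conjRow {n : ℕ} (s : ℝ) (w : ℂ) (l : Fin n) : Continuous (conjRow s w l) := by
  unfold conjRow
  fun_prop

theorem toEuclideanLin_shiftedMatrix_apply {Ω : Type*} {n : ℕ} (ξ δ : Fin n → Fin n → Ω → ℝ)
    {p : ℝ} (w : ℂ) (ω : Ω) (hs : √(n * p) ≠ 0) (x : EuclideanSpace ℂ (Fin n)) (l : Fin n) :
    Matrix.toEuclideanLin (shiftedMatrix ξ δ p w ω) x l
      = inner ℂ (((√(n * p))⁻¹ : ℂ) • conjRow √(n * p) w l fun a => ξ l a ω * δ l a ω) x := by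
  have hs' : (√(n * p) : ℂ) ≠ 0 := by exact_mod_cast hs
  have h1 : Matrix.toEuclideanLin (shiftedMatrix ξ δ p w ω) x l
      = (shiftedMatrix ξ δ p w ω).mulVec x l := rfl
  rw [h1, conjRow, shiftedMatrix, Matrix.sub_mulVec, Matrix.smul_mulVec, Matrix.one_mulVec,
    inner_smul_left, inner_sub_left, sum_inner, inner_smul_left]
  simp only [inner_smul_left, EuclideanSpace.basisFun_inner, Complex.conj_ofReal, map_mul,
    Complex.conj_conj, map_inv₀, Pi.sub_apply, Pi.smul_apply, smul_eq_mul, mul_sub]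
  congr 1
  · rw [Matrix.mulVec, dotProduct, Finset.mul_sum]
    refine Finset.sum_congr rfl fun a _ => ?_
    simp only [Matrix.of_apply]
    push_cast
    field_simp
  · field_simp

variable {Ω : Type*} [MeasurableSpace Ω] {P : Measure Ω} [IsProbabilityMeasure P] {n : ℕ}
  {ξ δ : Fin n → Fin n → Ω → ℝ} {p : ℝ}

/-- Row `j` is unlikely to be close to the span of the other rows among the first `m ≤ n - k`. -/
theorem IsSparseArray.measureReal_dist_rows_lt_le (h : IsSparseArray P ξ δ p) (hp0 : 0 ≤ p)
    (hp1 : p ≤ 1) {K : ℝ} (hK : 1 ≤ K)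
    (htail : ∀ i j, ∫ ω in {ω | K < |ξ i j ω|}, ξ i j ω ^ 2 ∂P ≤ 1 / 4)
    (s : ℝ) (w : ℂ) {m k : ℕ} (hmk : m + k ≤ n) (j : Fin n) (hj : (j : ℕ) < m) (τ : ℝ) :
    P.real {ω | ∃ z ∈ Submodule.span ℂ
        ((fun l : {l : Fin n // (l : ℕ) < m} => conjRow s w l fun a => ξ l a ω * δ l a ω) ''
          {⟨j, hj⟩}ᶜ),
        ‖conjRow s w j (fun a => ξ j a ω * δ j a ω) - z‖ < τ}
      ≤ Real.exp (τ ^ 2 / (4 * K ^ 2) - p / 4 * k / (16 * K ^ 2)) := by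
  classical
  set b := EuclideanSpace.basisFun (Fin n) ℂ with hb
  let X : Ω → Fin n → ℝ := fun ω a => ξ j a ω * δ j a ω
  let Y : Ω → ({j}ᶜ : Finset (Fin n)) → Fin n → ℝ := fun ω l a => ξ l a ω * δ l a ω
  have hX : Measurable X := measurable_pi_lambda _ fun a => h.measurable_mul j a
  have hY : Measurable Y :=
    measurable_pi_lambda _ fun l => measurable_pi_lambda _ fun a => h.measurable_mul l a
  have hμ : ∀ a, IsProbabilityMeasure (P.map fun ω => ξ j a ω * δ j a ω) := fun a =>
    Measure.isProbabilityMeasure_map (h.measurable_mul j a).aemeasurable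
  -- Adjoining the basis vector `b j` to the other rows absorbs the shift in row `j`.
  let g : {l : Fin n // (l : ℕ) < m} → (({j}ᶜ : Finset (Fin n)) → Fin n → ℝ) →
      EuclideanSpace ℂ (Fin n) := fun l y =>
    if hl : (l : Fin n) = j then b j
    else conjRow s w l (y ⟨l, by simpa using hl⟩)
  have hg : ∀ l, Continuous (g l) := by
    intro l
    by_cases hl : (l : Fin n) = j
    · have hgl : g l = fun _ => b j := funext fun y => dif_pos hl
      rw [hgl]
      exact continuous_const
    · have hl' : (l : Fin n) ∈ ({j}ᶜ : Finset (Fin n)) := by simpa using hl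
      have hgl : g l = fun y => conjRow s w l (y ⟨l, hl'⟩) := funext fun y => dif_neg hl
      rw [hgl]
      have h1 : Continuous fun y : ({j}ᶜ : Finset (Fin n)) → Fin n → ℝ => y ⟨l, hl'⟩ :=
        continuous_apply _
      exact (continuous_conjRow s w (l : Fin n)).comp h1
  have hcard : Fintype.card {l : Fin n // (l : ℕ) < m} + k ≤ Fintype.card (Fin n) := by
    rw [Fintype.card_subtype, Fin.card_filter_val_lt, Fintype.card_fin]
    omega
  have hlaw : P.map X = Measure.pi fun a => P.map fun ω => ξ j a ω * δ j a ω := h.map_row_eq_pi j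
  have hXY : IndepFun X Y P := h.indepFun_row_compl j
  have hv : ∀ a, p / 4 ≤ ∫ z, halfDiff K z ^ 2
      ∂((P.map fun ω => ξ j a ω * δ j a ω).prod (P.map fun ω => ξ j a ω * δ j a ω)) :=
    fun a => h.le_integral_halfDiff_sq hp0 hp1 hK j a (htail j a)
  have hmain := measureReal_exists_norm_sub_lt_le
    (fun a => P.map fun ω => ξ j a ω * δ j a ω) (zero_lt_one.trans_le hK)
    (by positivity : 0 ≤ p / 4) hv b hX hY hlaw hXY hg hcard τ
  refine (measureReal_mono ?_).trans hmain
  rintro ω ⟨z, hz, hlt⟩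
  have hmem : z + (s * starRingEnd ℂ w) • b j ∈
      Submodule.span ℂ (Set.range fun l => g l (Y ω)) := by
    refine Submodule.add_mem _ (Submodule.span_le.2 ?_ hz) (Submodule.smul_mem _ _ ?_)
    · rintro _ ⟨l, hl, rfl⟩
      refine Submodule.subset_span ⟨l, ?_⟩
      have hl' : (l : Fin n) ≠ j := fun h => hl (Subtype.ext h)
      simp only [g, hl', dif_neg, not_false_eq_true, Y]
    · exact Submodule.subset_span ⟨⟨j, hj⟩, by simp [g]⟩
  obtain ⟨c, hc⟩ := (Submodule.mem_span_range_iff_exists_fun ℂ).1 hmem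
  refine ⟨c, ?_⟩
  have e : ∑ a, (X ω a : ℂ) • b a - (z + (s * starRingEnd ℂ w) • b j)
      = conjRow s w j (fun a => ξ j a ω * δ j a ω) - z := by
    unfold conjRow
    rw [sub_add_eq_sub_sub_swap]
  rwa [hc, e]

end Rows

/-! ### Small singular values -/

section SmallSingularValues
open Module

/-- If the `(n - i)`-th largest singular value is small, then one of the first `n - k` rows is close to
the span of the others. -/
theorem exists_row_near_span_of_singularValue_le {Ω : Type*} {n : ℕ}
    (ξ δ : Fin n → Fin n → Ω → ℝ) {p : ℝ} (hp : 0 < p) (w : ℂ) (ω : Ω) {i k : ℕ} (hi : i < n)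
    (hk : k ≤ n) {t τ : ℝ} (hτ : 0 < τ)
    (hsv : singularValue (shiftedMatrix ξ δ p w ω) (n - i) ≤ t)
    (hlt : ((n - k : ℕ) : ℝ) * (t ^ 2 * (n * p)) < ((i : ℝ) + 1 - k) * τ ^ 2) :
    ∃ j : {l : Fin n // (l : ℕ) < n - k}, ∃ z ∈ Submodule.span ℂ
        ((fun l : {l : Fin n // (l : ℕ) < n - k} =>
          conjRow √(n * p) w l fun a => ξ l a ω * δ l a ω) '' {j}ᶜ),
        ‖conjRow √(n * p) w j (fun a => ξ j a ω * δ j a ω) - z‖ < τ := by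
  by_contra! hcon
  have hn : (0 : ℝ) < n := by exact_mod_cast (Nat.zero_le i).trans_lt hi
  have hs : 0 < √(n * p) := Real.sqrt_pos.2 (by positivity)
  obtain ⟨V, hVdim, hV⟩ := exists_submodule_norm_le_of_singularValues_le
    (Matrix.toEuclideanLin (shiftedMatrix ξ δ p w ω)) (n := n) (k := n - i - 1) (by simp)
    (by omega) hsv
  have hVsum : ∀ x ∈ V, ∑ j : {l : Fin n // (l : ℕ) < n - k},
      ‖inner ℂ (conjRow √(n * p) w j fun a => ξ j a ω * δ j a ω) x‖ ^ 2
        ≤ (√(n * p) * t) ^ 2 * ‖x‖ ^ 2 := by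
    intro x hx
    have h1 : ∀ j : Fin n, ‖inner ℂ (conjRow √(n * p) w j fun a => ξ j a ω * δ j a ω) x‖ ^ 2
        = √(n * p) ^ 2
          * ‖Matrix.toEuclideanLin (shiftedMatrix ξ δ p w ω) x j‖ ^ 2 := by
      intro j
      rw [toEuclideanLin_shiftedMatrix_apply ξ δ w ω hs.ne', inner_smul_left, norm_mul,
        RCLike.norm_conj, norm_inv, Complex.norm_real, Real.norm_of_nonneg hs.le]
      field_simp
    calc _ = ∑ j : {l : Fin n // (l : ℕ) < n - k}, √(n * p) ^ 2
          * ‖Matrix.toEuclideanLin (shiftedMatrix ξ δ p w ω) x j‖ ^ 2 :=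
        Finset.sum_congr rfl fun j _ => h1 j
      _ ≤ ∑ j : Fin n, √(n * p) ^ 2
          * ‖Matrix.toEuclideanLin (shiftedMatrix ξ δ p w ω) x j‖ ^ 2 :=
        (Finset.sum_map Finset.univ (Function.Embedding.subtype _) fun j => √(n * p) ^ 2
          * ‖Matrix.toEuclideanLin (shiftedMatrix ξ δ p w ω) x j‖ ^ 2).symm.trans_le
          (Finset.sum_le_sum_of_subset_of_nonneg (Finset.subset_univ _)
            fun _ _ _ => by positivity)
      _ = √(n * p) ^ 2 * ‖Matrix.toEuclideanLin (shiftedMatrix ξ δ p w ω) x‖ ^ 2 := by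
        rw [← Finset.mul_sum, EuclideanSpace.norm_sq_eq]
      _ ≤ √(n * p) ^ 2 * (t * ‖x‖) ^ 2 := by
        have := hV x hx
        gcongr
      _ = _ := by ring
  have hfin := finrank_mul_sq_le_of_dist_span
    (fun l : {l : Fin n // (l : ℕ) < n - k} =>
      conjRow √(n * p) w l fun a => ξ l a ω * δ l a ω) hτ hcon V hVsum
  have hcard : Fintype.card {l : Fin n // (l : ℕ) < n - k} = n - k := by
    rw [Fintype.card_subtype, Fin.card_filter_val_lt]; omega
  have hVd : finrank ℂ V = i + 1 := by omega
  rw [hcard, hVd, finrank_euclideanSpace_fin, mul_pow, Real.sq_sqrt (by positivity)] at hfin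
  push_cast [hk] at hfin hlt
  nlinarith

theorem theorem2p3 (tail : ℝ → ℝ) :
    ∃ c > (0 : ℝ), ∃ C > (0 : ℝ),
      ∀ (p : ℕ → ℝ) (ψ : ℕ → ℕ) (n : ℕ),
        0 < p n → p n ≤ 1 → ψ n < n →
        C * Real.log n ≤ min (p n * ψ n) ((ψ n : ℝ) ^ 2 / n) →
        ∀ (w : ℂ), ‖w‖ < 1 →
        ∀ {Ω : Type*} [MeasurableSpace Ω] (P : Measure Ω) [IsProbabilityMeasure P]
          (ξ δ : Fin n → Fin n → Ω → ℝ),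
          IsSparseArray P ξ δ (p n) →
          -- the entries `ξ i j` have the given tail
          (∀ i j, ∀ t : ℝ, 0 ≤ t → P.real {ω | t < |ξ i j ω|} = tail t) →
          P.real (⋃ i ∈ Finset.Icc (3 * ψ n) (n - 1),
              {ω | singularValue (shiftedMatrix ξ δ (p n) w ω) (n - i) ≤ c * (i / n)})
            ≤ 2 / (n : ℝ) ^ 2 := by
  obtain ⟨K, hK, hKtail⟩ := exists_truncation_level tail
  -- The argument for `s_{n - i}` needs `i ^ 2 / 192 > c ^ 2 * i ^ 2`, whence `c = 1 / 20`, and a row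
  -- fails with probability at most `exp (-p k / (128 K ^ 2)) ≤ n ^ (-4)`, whence `C = 512 K ^ 2`.
  refine ⟨1 / 20, by norm_num, 512 * K ^ 2, by positivity, ?_⟩
  intro p ψ n hp0 hp1 hψn hC w _ Ω _ P _ ξ δ h htail
  -- For `n = 1` the bound exceeds `1`; for `n ≥ 2` the logarithm is positive, so that `ψ n ≥ 1`.
  rcases Nat.lt_or_ge n 2 with hn2 | hn2
  · have hn1 : n = 1 := by omega
    refine measureReal_le_one.trans ?_
    rw [hn1]
    norm_num
  have hn0 : (0 : ℝ) < n := by positivity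
  have hlog : 0 < Real.log n := Real.log_pos (by exact_mod_cast hn2)
  have hpψ : 512 * K ^ 2 * Real.log n ≤ p n * ψ n := hC.trans (min_le_left _ _)
  have hψ1 : 1 ≤ ψ n := by
    rcases Nat.eq_zero_or_pos (ψ n) with h0 | h0
    · rw [h0] at hpψ
      have : 0 < 512 * K ^ 2 * Real.log n := by positivity
      simp only [Nat.cast_zero, mul_zero] at hpψ
      linarith
    · exact h0
  have htr : ∀ i j, ∫ ω in {ω | K < |ξ i j ω|}, ξ i j ω ^ 2 ∂P ≤ 1 / 4 := fun i j =>
    hKtail P (ξ i j) (h.measurable_xi i j) (h.memLp_xi i j) (htail i j)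
  -- To bound `s_{n - i}`, the last `⌊i / 2⌋` rows are discarded. The threshold `τ i` is chosen so
  -- that `τ ^ 2 / (4 K ^ 2)` is half of the main term `(p / 4) k / (16 K ^ 2)` in the exponent.
  let k : ℕ → ℕ := fun i => i / 2
  let τ : ℕ → ℝ := fun i => √(p n * k i / 32)
  let bad : (i : ℕ) → {l : Fin n // (l : ℕ) < n - k i} → Set Ω := fun i j =>
    {ω | ∃ z ∈ Submodule.span ℂ
        ((fun l : {l : Fin n // (l : ℕ) < n - k i} =>
          conjRow √(n * p n) w l fun a => ξ l a ω * δ l a ω) '' {j}ᶜ),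
        ‖conjRow √(n * p n) w j (fun a => ξ j a ω * δ j a ω) - z‖ < τ i}
  have hI : ∀ i ∈ Finset.Icc (3 * ψ n) (n - 1), 3 ≤ i ∧ i < n ∧ ψ n ≤ k i ∧ k i ≤ n ∧ 1 ≤ k i ∧
      i ≤ 3 * k i ∧ 2 * k i ≤ i := by
    intro i hi
    rw [Finset.mem_Icc] at hi
    simp only [k]
    omega
  have hsub : ∀ i ∈ Finset.Icc (3 * ψ n) (n - 1),
      {ω | singularValue (shiftedMatrix ξ δ (p n) w ω) (n - i) ≤ 1 / 20 * (i / n)}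
        ⊆ ⋃ j ∈ Finset.univ, bad i j := by
    intro i hi ω hω
    obtain ⟨hi3, hin, -, hkn, hk1, hik, hki⟩ := hI i hi
    have hk0 : (0 : ℝ) < k i := by exact_mod_cast hk1
    have hi0 : (0 : ℝ) < i := by exact_mod_cast (by omega : 0 < i)
    have hik' : (i : ℝ) ≤ 3 * k i := by exact_mod_cast hik
    have hki' : 2 * (k i : ℝ) ≤ i := by exact_mod_cast hki
    obtain ⟨j, hj⟩ := exists_row_near_span_of_singularValue_le ξ δ hp0 w ω hin hkn
      (Real.sqrt_pos.2 (by positivity) : 0 < τ i) hω (by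
        rw [Real.sq_sqrt (by positivity)]
        have h1 : ((n - k i : ℕ) : ℝ) ≤ n := by exact_mod_cast Nat.sub_le _ _
        calc ((n - k i : ℕ) : ℝ) * ((1 / 20 * (i / n)) ^ 2 * (n * p n))
            ≤ n * ((1 / 20 * (i / n)) ^ 2 * (n * p n)) := by gcongr
          _ = (i * i / 400) * p n := by field_simp; norm_num
          _ < (i * i / 192) * p n := by
              have : (0 : ℝ) < i * i := by positivity
              gcongr
              norm_num
          _ ≤ (i / 2) * (k i / 32) * p n := by
              gcongr
              nlinarith
          _ ≤ ((i : ℝ) + 1 - k i) * (k i / 32) * p n := by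
              gcongr
              linarith
          _ = ((i : ℝ) + 1 - k i) * (p n * k i / 32) := by ring)
    exact Set.mem_biUnion (Finset.mem_univ j) hj
  have hbad : ∀ i ∈ Finset.Icc (3 * ψ n) (n - 1), ∀ j, P.real (bad i j) ≤ ((n : ℝ) ^ 4)⁻¹ := by
    intro i hi j
    obtain ⟨-, -, hψk, hkn, -, -, -⟩ := hI i hi
    have h1 := h.measureReal_dist_rows_lt_le hp0.le hp1 hK htr √(n * p n) w
      (Nat.sub_add_cancel hkn).le j j.2 (τ i)
    refine h1.trans ?_
    have h2 : ((n : ℝ) ^ 4)⁻¹ = Real.exp (-(4 * Real.log n)) := by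
      rw [Real.exp_neg, mul_comm, Real.exp_mul, Real.exp_log hn0]
      norm_cast
    rw [h2, Real.exp_le_exp]
    simp only [τ]
    rw [Real.sq_sqrt (by positivity)]
    have h3 : 512 * K ^ 2 * Real.log n ≤ p n * k i :=
      hpψ.trans (mul_le_mul_of_nonneg_left (by exact_mod_cast hψk) hp0.le)
    have h4 : p n * k i / 32 / (4 * K ^ 2) - p n / 4 * k i / (16 * K ^ 2)
        = -(p n * k i / (128 * K ^ 2)) := by
      field_simp; ring
    rw [h4, neg_le_neg_iff, le_div_iff₀ (by positivity)]
    linarith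
  calc _ ≤ P.real (⋃ i ∈ Finset.Icc (3 * ψ n) (n - 1), ⋃ j ∈ Finset.univ, bad i j) :=
        measureReal_mono (Set.iUnion₂_mono hsub) (measure_ne_top _ _)
    _ ≤ ∑ i ∈ Finset.Icc (3 * ψ n) (n - 1), P.real (⋃ j ∈ Finset.univ, bad i j) :=
        measureReal_biUnion_finset_le _ _
    _ ≤ ∑ i ∈ Finset.Icc (3 * ψ n) (n - 1), ∑ j, P.real (bad i j) :=
        Finset.sum_le_sum fun i _ => measureReal_biUnion_finset_le _ _
    _ ≤ ∑ i ∈ Finset.Icc (3 * ψ n) (n - 1), ∑ _j : {l : Fin n // (l : ℕ) < n - k i},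
          ((n : ℝ) ^ 4)⁻¹ :=
        Finset.sum_le_sum fun i hi => Finset.sum_le_sum fun j _ => hbad i hi j
    _ ≤ ∑ i ∈ Finset.Icc (3 * ψ n) (n - 1), n * ((n : ℝ) ^ 4)⁻¹ := by
        refine Finset.sum_le_sum fun i _ => ?_
        rw [Finset.sum_const, nsmul_eq_mul]
        gcongr
        rw [Finset.card_univ]
        exact (Fintype.card_subtype_le _).trans_eq (Fintype.card_fin n)
    _ ≤ n * (n * ((n : ℝ) ^ 4)⁻¹) := by
        rw [Finset.sum_const, nsmul_eq_mul]
        gcongr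
        rw [Nat.card_Icc]
        omega
    _ = 1 / (n : ℝ) ^ 2 := by field_simp
    _ ≤ 2 / (n : ℝ) ^ 2 := by gcongr; norm_num

end SmallSingularValues
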